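/- Fix $N\ge 1$. For a lower triangular $H=[h_{k,j}]\in\mathbb R^{(N-1)\times(N-1)}$ and an operator $T$ on a real Hilbert space consider the algorithm $$y_{k+1}=y_k-\sum_{j=0}^{k}h_{k+1,j+1}\,(y_j-Ty_j),\qquad k=0,\dots,N-2 .$$ Let $\mathcal H_\star(N-1)$ be the set of all lower triangular $H$ for which $$\|y_{N-1}-Ty_{N-1}\|^2\le \frac{4\|y_0-y_\star\|^2}{N^2}$$ for every nonexpansive operator $T$ on every real Hilbert space, every fixed point $y_\star$ of $T$ and every $y_0$. Put $$Q(m,j;H)=\sum_{j=j(1)\le i(1)<j(2)\le i(2)<\dots<j(m)\le i(m)\le N-1}\ \prod_{r=1}^m h_{i(r),j(r)},$$ $$\lambda^\star_{N,j}(H)=N\sum_{m=1}^{N-1}(-1)^{m-1}Q(m,j;H)\qquad(1\le j\le N-1),$$ $$\lambda^\star_{k,j}(H)=N\sum_{\ell=1}^{N-1}\sum_{m=1}^{N-1}(-1)^{\ell+m-1}\binom{\ell+m}{m}Q(\ell,j;H)\,Q(m,k;H)\qquad(1\le j<k\le N-1).$$ An arc diagram on the nodes $\{1,\dots,N\}$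 is a graph with edges $(k(j),j)$, $1\le j\le N-1$, where $j<k(j)\le N$. A matrix $H\in\mathcal H_\star(N-1)$ is a vertex algorithm if for every $j\in\{1,\dots,N-1\}$ there is exactly one $k(j)\in\{j+1,\dots,N\}$ with $\lambda^\star_{k(j),j}(H)>0$, while $\lambda^\star_{k,j}(H)=0$ for all other $k>j$; its arc diagram $\mathcal G(H)$ has the edges $(k(j),j)$. The H-dual of $H$ is its anti-diagonal transpose $H^{\mathsf A}=[h_{N-j,N-k}]_{k,j}$. The gluing $\mathcal G_1\bowtie\mathcal G_2$ of arc diagrams on $N_1$ and $N_2$ nodes is the arc diagram on $N_1+N_2$ nodes obtained by placing $\mathcal G_2$ to the right of $\mathcal G_1$ (shifting its labels by $N_1$) and adding the arc $(N_1+N_2,N_1)$. An arc diagram is basic if it is the single-node diagram or a gluing of basic diagrams (equivalently, it is non-crossing). It is decomposable at $N'\in\{1,\dots,N-1\}$ if $k(N')=N$ and $k(j)\le N'$ for all $j<N'$; then $\mathcal G_{1,N'}$ and $\mathcal G_{N'+1,N}$ (relabelled to $\{1,\dots,N-N'\}$) denote the two components obtained by removing the arc $(N,N')$, so that $\mathcal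 G=\mathcal G_{1,N'}\bowtie\mathcal G_{N'+1,N}$. **Corollary.** Let $\mathcal G$ be a basic arc diagram on $\{1,\dots,N\}$ that is decomposable at $N'\in\{1,\dots,N-1\}$. Then each of $\mathcal G$, $\mathcal G_{1,N'}$, $\mathcal G_{N'+1,N}$ has a well-defined dual diagram, where the dual of a diagram $\mathcal D$ is $\mathcal D^{\mathsf A}:=\mathcal G(H^{\mathsf A})$ for the unique vertex algorithm $H$ with $\mathcal G(H)=\mathcal D$ (that is, exactly one such $H$ exists, and $H^{\mathsf A}$ is again a vertex algorithm), and $$\mathcal G^{\mathsf A}=\mathcal G_{N'+1,N}^{\mathsf A}\bowtie\mathcal G_{1,N'}^{\mathsf A}.$$ -/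

import Mathlib

noncomputable section

namespace ArcDuality

/-- An arc diagram on the nodes `1, …, nodes`: every node `j < nodes` carries exactly one arc to a
larger node, namely to `target j`.  The edge set is `{(target j, j) : 1 ≤ j < nodes}`; `target` is
normalised to `0` off `{1, …, nodes - 1}`, so two arc diagrams are equal exactly when they
have the same nodes and the same edges. -/
@[ext]
structure ArcDiagram where
  nodes : ℕ
  target : ℕ → ℕ
  nodes_pos : 1 ≤ nodes
  lt_target : ∀ j, 1 ≤ j → j < nodes → j < target j
  target_le : ∀ j, 1 ≤ j → j < nodes → target j ≤ nodes
  target_eq_zero : ∀ j, ¬ (1 ≤ j ∧ j < nodes) → target j = 0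

namespace ArcDiagram

/-- The diagram with a single node and no arc. -/
def single : ArcDiagram where
  nodes := 1
  target := fun _ => 0
  nodes_pos := le_rfl
  lt_target := by intros; omega
  target_le := by intros; omega
  target_eq_zero := by intros; rfl

/-- The gluing `G₁ ⋈ G₂`: place `G₂` to the right of `G₁` (shifting its labels by `G₁.nodes`) and
insert an arc joining the rightmost nodes of `G₁` and `G₂`. -/
def glue (G₁ G₂ : ArcDiagram) : ArcDiagram where
  nodes := G₁.nodes + G₂.nodes
  target := fun j =>
    if j < G₁.nodes then G₁.target j
    else if j = G₁.nodes then G₁.nodes + G₂.nodes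
    else if j < G₁.nodes + G₂.nodes then G₁.nodes + G₂.target (j - G₁.nodes)
    else 0
  nodes_pos := by have := G₁.nodes_pos; omega
  lt_target := by
    intro j h1 h2
    have := G₂.nodes_pos
    split_ifs with h3 h4
    · exact G₁.lt_target j h1 h3
    · omega
    · have := G₂.lt_target (j - G₁.nodes) (by omega) (by omega)
      omega
  target_le := by
    intro j h1 h2
    split_ifs with h3 h4
    · have := G₁.target_le j h1 h3
      omega
    · omega
    · have := G₂.target_le (j - G₁.nodes) (by omega) (by omega)
      omega
  target_eq_zero := by
    intro j hj
    have := G₁.nodes_pos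
    have := G₂.nodes_pos
    split_ifs with h3 h4 h5
    · exact G₁.target_eq_zero j (by omega)
    · omega
    · omega
    · rfl

/-- Basic diagrams: the single node diagram, and gluings of basic diagrams. -/
inductive IsBasic : ArcDiagram → Prop
  | single : IsBasic single
  | glue {G₁ G₂ : ArcDiagram} : IsBasic G₁ → IsBasic G₂ → IsBasic (glue G₁ G₂)

/-- `G` is decomposable at the node `N'`. -/
def DecomposableAt (G : ArcDiagram) (N' : ℕ) : Prop :=
  1 ≤ N' ∧ N' < G.nodes ∧ G.target N' = G.nodes ∧ ∀ j, 1 ≤ j → j < N' → G.target j ≤ N'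

/-- The component on the nodes `1, …, N'` left after removing the arc `(G.nodes, N')`. -/
def left (G : ArcDiagram) (N' : ℕ) (h : G.DecomposableAt N') : ArcDiagram where
  nodes := N'
  target := fun j => if j < N' then G.target j else 0
  nodes_pos := h.1
  lt_target := by
    intro j h1 h2
    have := G.lt_target j h1 (h2.trans h.2.1)
    simpa [h2] using this
  target_le := by
    intro j h1 h2
    simpa [h2] using h.2.2.2 j h1 h2
  target_eq_zero := by
    intro j hj
    split_ifs with h2
    · exact G.target_eq_zero j (by omega)
    · rfl

/-- The component on the nodes `N' + 1, …, G.nodes` left after removing the arc `(G.nodes, N')`,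
relabelled to `1, …, G.nodes - N'`. -/
def right (G : ArcDiagram) (N' : ℕ) (h : G.DecomposableAt N') : ArcDiagram where
  nodes := G.nodes - N'
  target := fun j => if 1 ≤ j ∧ j < G.nodes - N' then G.target (N' + j) - N' else 0
  nodes_pos := by have := h.2.1; omega
  lt_target := by
    intro j h1 h2
    have := G.lt_target (N' + j) (by omega) (by omega)
    rw [if_pos ⟨h1, h2⟩]
    omega
  target_le := by
    intro j h1 h2
    have := G.target_le (N' + j) (by omega) (by omega)
    rw [if_pos ⟨h1, h2⟩]
    omega
  target_eq_zero := by
    intro j hj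
    rw [if_neg hj]

end ArcDiagram

/-- Step-size matrices of `(N - 1)`-step algorithms. -/
abbrev HMatrix (N : ℕ) : Type := Matrix (Fin (N - 1)) (Fin (N - 1)) ℝ

/-- The entry `h_{i,j}` for labels `i, j ∈ {1, …, N - 1}` (and `0` for other labels). -/
def entry {N : ℕ} (H : HMatrix N) (i j : ℕ) : ℝ :=
  if h : (1 ≤ i ∧ i ≤ N - 1) ∧ (1 ≤ j ∧ j ≤ N - 1) then
    H ⟨i - 1, by omega⟩ ⟨j - 1, by omega⟩
  else 0

def IsLowerTriangular {N : ℕ} (H : HMatrix N) : Prop :=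
  ∀ i j, i < j → H i j = 0

/-- The anti-diagonal transpose `Hᴬ`, with entries `(Hᴬ)_{k,j} = h_{N-j,N-k}`. -/
def hDual {N : ℕ} (H : HMatrix N) : HMatrix N :=
  Matrix.of fun k j => H j.rev k.rev

/-- `y 0, …, y (N - 1)` are the iterates produced by the step-size matrix `H` on the operator `T`,
`y_{k+1} = y_k - ∑_{j=0}^{k} h_{k+1,j+1} (y_j - T y_j)` for `k = 0, …, N - 2`. -/
def IsIterates {N : ℕ} (H : HMatrix N) {X : Type} [NormedAddCommGroup X] [InnerProductSpace ℝ X]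
    (T : X → X) (y : ℕ → X) : Prop :=
  ∀ k, k < N - 1 →
    y (k + 1) = y k - ∑ j ∈ Finset.range (k + 1), entry H (k + 1) (j + 1) • (y j - T (y j))

/-- The set `𝓗⋆(N - 1)` of lower triangular step-size matrices whose algorithm attains the exact
minimax optimal rate `‖y_{N-1} - T y_{N-1}‖² ≤ 4 ‖y₀ - y⋆‖² / N²` for every nonexpansive operator
with a fixed point `y⋆`, on every real Hilbert space. -/
def optimalSet (N : ℕ) : Set (HMatrix N) :=
  {H | IsLowerTriangular H ∧
    ∀ (X : Type) [NormedAddCommGroup X] [InnerProductSpace ℝ X] [CompleteSpace X]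
      (T : X → X), (∀ x x', ‖T x - T x'‖ ≤ ‖x - x'‖) →
      ∀ yfix : X, T yfix = yfix →
      ∀ y : ℕ → X, IsIterates H T y →
        ‖y (N - 1) - T (y (N - 1))‖ ^ 2 ≤ 4 * ‖y 0 - yfix‖ ^ 2 / (N : ℝ) ^ 2}

/-- The index chains `j = j(1) ≤ i(1) < j(2) ≤ i(2) < ⋯ < j(m) ≤ i(m) ≤ N - 1`; the `r`-th member
of a chain `c` is the pair `c r = (i(r), j(r))`. -/
def chains (N m j : ℕ) : Finset (Fin m → ℕ × ℕ) :=
  (Fintype.piFinset fun _ => Finset.Icc 1 (N - 1) ×ˢ Finset.Icc 1 (N - 1)).filter fun c =>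
    (∀ r : Fin m, r.val = 0 → (c r).2 = j) ∧
    (∀ r : Fin m, (c r).2 ≤ (c r).1) ∧
    (∀ r s : Fin m, r.val + 1 = s.val → (c r).1 < (c s).2)

/-- The Q-function `Q(m, j; H) = ∑ ∏_{r=1}^{m} h_{i(r),j(r)}`, for `m ≥ 1`. -/
def qFun {N : ℕ} (H : HMatrix N) (m j : ℕ) : ℝ :=
  ∑ c ∈ chains N m j, ∏ r, entry H (c r).1 (c r).2

/-- The H-certificate `λ⋆_{k,j}(H)`, for `1 ≤ j < k ≤ N`. -/
def certificate {N : ℕ} (H : HMatrix N) (k j : ℕ) : ℝ :=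
  if k = N then
    (N : ℝ) * ∑ m ∈ Finset.Icc 1 (N - 1), (-1 : ℝ) ^ (m - 1) * qFun H m j
  else
    (N : ℝ) * ∑ l ∈ Finset.Icc 1 (N - 1), ∑ m ∈ Finset.Icc 1 (N - 1),
      (-1 : ℝ) ^ (l + m - 1) * ((l + m).choose m : ℝ) * qFun H l j * qFun H m k

/-- `H` is an optimal vertex algorithm: `H ∈ 𝓗⋆(N - 1)`, and for every `j ∈ {1, …, N - 1}` exactly
one of the certificates `λ⋆_{k,j}(H)`, `j < k ≤ N`, is positive while all the others vanish. -/
def IsVertex {N : ℕ} (H : HMatrix N) : Prop :=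
  H ∈ optimalSet N ∧
    ∀ j, 1 ≤ j → j < N → ∃ k, j < k ∧ k ≤ N ∧ 0 < certificate H k j ∧
      ∀ l, j < l → l ≤ N → l ≠ k → certificate H l j = 0

/-- `H` is a vertex algorithm and `G` is its arc diagram `𝓖(H)`: the graph on `1, …, N` whose edges
are the pairs `(k, j)`, `j < k`, of nonzero weight `λ⋆_{k,j}(H)`. -/
def IsVertexWithDiagram {N : ℕ} (H : HMatrix N) (G : ArcDiagram) : Prop :=
  IsVertex H ∧ G.nodes = N ∧
    ∀ j k, 1 ≤ j → j < k → k ≤ N → (certificate H k j ≠ 0 ↔ G.target j = k)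

/-- `D` is the H-dual diagram `𝓖ᴬ` of `G`: there is exactly one vertex algorithm `H` with arc
diagram `G`, its H-dual `Hᴬ` is again a vertex algorithm, and `D` is the arc diagram of `Hᴬ`. -/
def ArcDiagram.IsHDual (G D : ArcDiagram) : Prop :=
  (∃! H : HMatrix G.nodes, IsVertexWithDiagram H G) ∧
    ∀ H : HMatrix G.nodes, IsVertexWithDiagram H G → IsVertexWithDiagram (hDual H) D

/-- An arc diagram has at most one H-dual diagram. -/
theorem ArcDiagram.IsHDual.unique {G D E : ArcDiagram} (hD : G.IsHDual D) (hE : G.IsHDual E) :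
    D = E := by
  obtain ⟨H, hH, -⟩ := hD.1
  obtain ⟨-, hn, h⟩ := hD.2 H hH
  obtain ⟨-, hn', h'⟩ := hE.2 H hH
  refine ArcDiagram.ext (hn.trans hn'.symm) (funext fun j => ?_)
  by_cases hj : 1 ≤ j ∧ j < G.nodes
  · have h1 := D.lt_target j hj.1 (by omega)
    have h2 := D.target_le j hj.1 (by omega)
    exact ((h' j _ hj.1 h1 (by omega)).1 ((h j _ hj.1 h1 (by omega)).2 rfl)).symm
  · rw [D.target_eq_zero j (by omega), E.target_eq_zero j (by omega)]

end ArcDuality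

end

/-!
The proof encodes step sizes by polynomials. For `H` let
`q_j = ∑ₘ Q(m, j; H) (X - 1) ^ m` for `j < N`, let `q_N = 1`, and let `S_i = q_{i+1} + ⋯ + q_N`.
Splitting off the first pair of a chain gives `q_j = (X - 1) ∑_{i ≥ j} h_{i,j} S_i`
(`isGenerated_qPoly`). By Vandermonde's identity the inner product of coefficient vectors satisfies
`⟨(X - 1) ^ l, (X - 1) ^ m⟩ = (-1) ^ (l + m) (l + m).choose m`, so that the certificates are Gram
entries: `λ⋆_{k,j} = -N ⟨q_j, q_k⟩` (`certificate_eq`).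

The optimal rate is governed by `S_0`. Since a linear operator has `y_{N-1} = S_0(T) y_0`, the
signed cyclic shift of `ℝᴺ` started at the all-ones vector turns the rate into a bound for the sum
of squares of the coefficients of `S_0`; these sum to one, and so they all equal `1 / N`
(`IsGenerated.tailSum_eq_geom`). Conversely, if `S_0 = (1 + ⋯ + X ^ (N - 1)) / N` and the inner
products of distinct `q_j` are nonpositive, the monotonicity inequalities weighted by these inner
products telescope to the optimal rate (`IsGenerated.norm_residual_le`). Hence a vertex algorithm
with diagram `G` is the same as a family `q` with this `S_0` whose members `q_j`, `q_k` are
orthogonal off the arcs of `G` and have negative inner product on the arcs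
(`isVertexWithDiagram_iff`).

For a gluing of diagrams on `N₁` and `N₂` nodes, the orthogonality relations force
`q_{N₁ + j} = q²_j`, `q_{N₁} = N₁ / N (X ^ N₂ - (1 + ⋯ + X ^ (N₂ - 1)) / N₂)` and
`q_j = N₁ / N X ^ N₂ q¹_j` for `j < N₁`, with families `q¹`, `q²` of the two parts
(`Represents.exists_eq_glueFamily`). This gives uniqueness by induction on basic diagrams, the step
sizes being recovered from the `S_i`, which have distinct degrees. The glued family in turn is
generated by explicit step sizes (`glueStep`) that contain those of the parts as diagonal blocks
and vanish outside these blocks and the row and column `N₁`. That matrix is compatible with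
anti-diagonal transposition, which exchanges the two parts (`dualStep_glueStep`), and the formula
for the dual of a gluing follows. Finally, a gluing is decomposable at its joint only.
-/

noncomputable section

namespace ArcDuality

open Polynomial Finset

/-! ### The inner product of coefficient vectors -/

/-- The bilinear form on `ℝ[X]` for which the monomials `X ^ n` are orthonormal. -/
def coeffDot : ℝ[X] →ₗ[ℝ] ℝ[X] →ₗ[ℝ] ℝ :=
  Polynomial.lsum fun n => LinearMap.toSpanSingleton ℝ (ℝ[X] →ₗ[ℝ] ℝ) (lcoeff ℝ n)

theorem coeffDot_eq_sum {p : ℝ[X]} {M : ℕ} (h : p.natDegree < M) (r : ℝ[X]) :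
    coeffDot p r = ∑ n ∈ range M, p.coeff n * r.coeff n := by
  rw [coeffDot, Polynomial.lsum_apply, p.sum_over_range' (by simp) M h, LinearMap.sum_apply]
  simp

theorem coeffDot_X_pow_left (n : ℕ) (r : ℝ[X]) : coeffDot (X ^ n) r = r.coeff n := by
  rw [coeffDot_eq_sum (M := n + 1) (by simp)]
  simp [coeff_X_pow]

theorem coeffDot_one_left (r : ℝ[X]) : coeffDot 1 r = r.coeff 0 := by
  simpa using coeffDot_X_pow_left 0 r

theorem coeffDot_comm (p r : ℝ[X]) : coeffDot p r = coeffDot r p := by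
  rw [coeffDot_eq_sum (M := p.natDegree + r.natDegree + 1) (by omega),
    coeffDot_eq_sum (M := p.natDegree + r.natDegree + 1) (by omega)]
  simp only [mul_comm]

theorem coeffDot_one_right (r : ℝ[X]) : coeffDot r 1 = r.coeff 0 := by
  rw [coeffDot_comm, coeffDot_one_left]

theorem coeffDot_X_pow_mul (d : ℕ) (p r : ℝ[X]) :
    coeffDot (X ^ d * p) (X ^ d * r) = coeffDot p r := by
  have h : (X ^ d * p).natDegree < d + (p.natDegree + 1) := by
    have := natDegree_mul_le (p := X ^ d) (q := p)
    rw [natDegree_X_pow] at this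
    omega
  rw [coeffDot_eq_sum h, coeffDot_eq_sum (Nat.lt_succ_self _), sum_range_add]
  have h0 : ∑ n ∈ range d, (X ^ d * p).coeff n * (X ^ d * r).coeff n = 0 := by
    refine sum_eq_zero fun n hn => ?_
    rw [coeff_X_pow_mul', if_neg (by simpa using hn), zero_mul]
  rw [h0, zero_add]
  refine sum_congr rfl fun n _ => ?_
  rw [add_comm d n, coeff_X_pow_mul, coeff_X_pow_mul]

/-- A polynomial of degree less than `d` is orthogonal to the multiples of `X ^ d`. -/
theorem coeffDot_X_pow_mul_left_eq_zero {d : ℕ} (p : ℝ[X]) {r : ℝ[X]} (hr : r.natDegree < d) :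
    coeffDot (X ^ d * p) r = 0 := by
  rw [coeffDot_comm, coeffDot_eq_sum hr]
  refine sum_eq_zero fun n hn => ?_
  rw [coeff_X_pow_mul', if_neg (by simpa using hn), mul_zero]

/-- The polynomial `1 + X + ⋯ + X ^ (n - 1)`. -/
def geom (n : ℕ) : ℝ[X] := ∑ i ∈ range n, X ^ i

theorem coeff_geom (n i : ℕ) : (geom n).coeff i = if i < n then 1 else 0 := by
  simp [geom, finsetSum_coeff, coeff_X_pow]

theorem eval_one_geom (n : ℕ) : (geom n).eval 1 = n := by
  simp [geom, eval_finsetSum]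

theorem X_sub_one_mul_geom (n : ℕ) : (X - 1) * geom n = X ^ n - 1 := by
  rw [geom, mul_geom_sum]

/-- The inner product with `geom n` is evaluation at `1` on polynomials of degree less than `n`. -/
theorem coeffDot_geom {n : ℕ} {r : ℝ[X]} (hr : r.natDegree < n) :
    coeffDot r (geom n) = r.eval 1 := by
  rw [coeffDot_eq_sum hr, eval_eq_sum_range' hr]
  refine sum_congr rfl fun i hi => ?_
  rw [coeff_geom, if_pos (by simpa using hi)]
  simp

/-- Vandermonde's identity gives the inner products of the powers of `X - 1`. -/
theorem coeffDot_X_sub_one_pow (l m : ℕ) :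
    coeffDot ((X - 1) ^ l) ((X - 1) ^ m) = (-1) ^ (l + m) * ((l + m).choose m : ℝ) := by
  have hc : ∀ n i : ℕ, ((X - 1 : ℝ[X]) ^ n).coeff i = (-1) ^ (n + i) * (n.choose i : ℝ) := by
    intro n i
    have : (X - 1 : ℝ[X]) = X + C (-1) := by simp [sub_eq_add_neg]
    rw [this, coeff_X_add_C_pow]
    rcases le_or_gt i n with h | h
    · congr 1
      rw [show n + i = n - i + 2 * i by omega, pow_add, pow_mul]
      simp
    · simp [Nat.choose_eq_zero_of_lt h]
  have hd : ((X - 1 : ℝ[X]) ^ l).natDegree < l + 1 := by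
    have := natDegree_pow_le (p := (X - 1 : ℝ[X])) (n := l)
    rw [show (X - 1 : ℝ[X]) = X - C 1 by simp, natDegree_X_sub_C] at this
    simpa using Nat.lt_succ_of_le this
  rw [coeffDot_eq_sum hd, Nat.add_choose_eq, Nat.sum_antidiagonal_eq_sum_range_succ_mk]
  have hext : ∑ n ∈ range m.succ, (l.choose n * m.choose (m - n) : ℕ)
      = ∑ n ∈ range (l + 1), l.choose n * m.choose n := by
    have h1 : ∑ n ∈ range m.succ, (l.choose n * m.choose (m - n) : ℕ)
        = ∑ n ∈ range (m + 1), l.choose n * m.choose n :=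
      sum_congr rfl fun n hn => by rw [Nat.choose_symm (by simp at hn; omega)]
    rw [h1]
    rcases le_total l m with h | h
    · symm
      refine sum_subset (by simpa using h) fun n _ hn => ?_
      rw [Nat.choose_eq_zero_of_lt (n := l) (by simpa using hn), zero_mul]
    · refine sum_subset (by simpa using h) fun n _ hn => ?_
      rw [Nat.choose_eq_zero_of_lt (n := m) (by simpa using hn), mul_zero]
  rw [hext]
  push_cast
  rw [mul_sum]
  refine sum_congr rfl fun i _ => ?_
  rw [hc, hc, pow_add _ l i, pow_add _ m i, pow_add _ l m]
  have : ((-1 : ℝ) ^ i) * (-1) ^ i = 1 := by rw [← mul_pow]; simp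
  linear_combination (-1 : ℝ) ^ l * (-1) ^ m * (l.choose i : ℝ) * (m.choose i : ℝ) * this

/-! ### Polynomial families generated by step sizes -/

/-- The sum `q (i + 1) + ⋯ + q N`. -/
def tailSum (N : ℕ) (q : ℕ → ℝ[X]) (i : ℕ) : ℝ[X] := ∑ k ∈ Ioc i N, q k

theorem tailSum_self (N : ℕ) (q : ℕ → ℝ[X]) : tailSum N q N = 0 := by simp [tailSum]

theorem tailSum_eq_add {N : ℕ} (q : ℕ → ℝ[X]) {i : ℕ} (hi : i < N) :
    tailSum N q i = q (i + 1) + tailSum N q (i + 1) := by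
  rw [tailSum, tailSum, ← Finset.insert_Ioc_succ_left_eq_Ioc hi, sum_insert (by simp)]
  rfl

/-- The combination `∑ h_{i,j} S_i` of the tail sums `S_i`, `j ≤ i < N`. -/
def columnSum (N : ℕ) (h : ℕ → ℕ → ℝ) (q : ℕ → ℝ[X]) (j : ℕ) : ℝ[X] :=
  ∑ i ∈ Ico j N, h i j • tailSum N q i

/-- The family `q 1, …, q N` generated by the step sizes `h`: it is determined by descending
recursion from `q N = 1`, and for `j < N` one has `q j = ∑ₘ Q(m, j) (X - 1) ^ m`. -/
structure IsGenerated (N : ℕ) (h : ℕ → ℕ → ℝ) (q : ℕ → ℝ[X]) : Prop where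
  last : q N = 1
  eq_mul : ∀ j, 1 ≤ j → j < N → q j = (X - 1) * columnSum N h q j

/-- The recursion determines the family. -/
theorem IsGenerated.unique {N : ℕ} {h : ℕ → ℕ → ℝ} {q r : ℕ → ℝ[X]} (hq : IsGenerated N h q)
    (hr : IsGenerated N h r) {j : ℕ} (h1 : 1 ≤ j) (h2 : j ≤ N) : q j = r j := by
  induction hd : N - j using Nat.strong_induction_on generalizing j with
  | _ d ih =>
    rcases h2.eq_or_lt with rfl | h2
    · rw [hq.last, hr.last]
    · rw [hq.eq_mul j h1 h2, hr.eq_mul j h1 h2, columnSum, columnSum]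
      congr 1
      refine sum_congr rfl fun i hi => ?_
      rw [mem_Ico] at hi
      congr 1
      refine sum_congr rfl fun k hk => ?_
      rw [mem_Ioc] at hk
      exact ih (N - k) (by omega) (by omega) hk.2 rfl

theorem IsGenerated.eval_one {N : ℕ} {h : ℕ → ℕ → ℝ} {q : ℕ → ℝ[X]} (hq : IsGenerated N h q)
    {j : ℕ} (h1 : 1 ≤ j) (h2 : j < N) : (q j).eval 1 = 0 := by
  rw [hq.eq_mul j h1 h2]
  simp

theorem natDegree_tailSum_le {N : ℕ} {q : ℕ → ℝ[X]} {i : ℕ}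
    (hq : ∀ k, i < k → k ≤ N → (q k).natDegree ≤ N - k) :
    (tailSum N q i).natDegree ≤ N - 1 - i := by
  refine natDegree_sum_le_of_forall_le _ _ fun k hk => ?_
  rw [mem_Ioc] at hk
  have := hq k hk.1 hk.2
  omega

theorem natDegree_columnSum_le {N : ℕ} (h : ℕ → ℕ → ℝ) {q : ℕ → ℝ[X]} {j : ℕ}
    (hq : ∀ k, j < k → k ≤ N → (q k).natDegree ≤ N - k) :
    (columnSum N h q j).natDegree ≤ N - 1 - j := by
  refine natDegree_sum_le_of_forall_le _ _ fun i hi => ?_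
  rw [mem_Ico] at hi
  have := natDegree_tailSum_le (i := i) fun k hk => hq k (by omega)
  exact (natDegree_smul_le _ _).trans (by omega)

theorem IsGenerated.natDegree_le {N : ℕ} {h : ℕ → ℕ → ℝ} {q : ℕ → ℝ[X]} (hq : IsGenerated N h q)
    {j : ℕ} (h1 : 1 ≤ j) (h2 : j ≤ N) : (q j).natDegree ≤ N - j := by
  induction hd : N - j using Nat.strong_induction_on generalizing j with
  | _ d ih =>
    rcases h2.eq_or_lt with rfl | h2
    · rw [hq.last]
      simp
    · rw [hq.eq_mul j h1 h2]
      refine natDegree_mul_le.trans ?_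
      have hX : (X - 1 : ℝ[X]).natDegree = 1 := by
        rw [show (X - 1 : ℝ[X]) = X - C 1 by simp, natDegree_X_sub_C]
      have hc := natDegree_columnSum_le (N := N) h (q := q) (j := j) fun k hk hk' =>
        ih (N - k) (by omega) (by omega) hk' rfl
      omega

/-- The leading coefficients satisfy `lead (q j) = h_{j,j} lead (q (j + 1))`. -/
theorem IsGenerated.coeff_eq_mul {N : ℕ} {h : ℕ → ℕ → ℝ} {q : ℕ → ℝ[X]} (hq : IsGenerated N h q)
    {j : ℕ} (h1 : 1 ≤ j) (h2 : j < N) :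
    (q j).coeff (N - j) = h j j * (q (j + 1)).coeff (N - (j + 1)) := by
  have hS : ∀ i, (tailSum N q i).natDegree ≤ N - 1 - i := fun i =>
    natDegree_tailSum_le fun k hk => hq.natDegree_le (by omega)
  have hc : (columnSum N h q j).natDegree ≤ N - 1 - j :=
    natDegree_columnSum_le h fun k hk => hq.natDegree_le (by omega)
  have hz : (tailSum N q (j + 1)).coeff (N - (j + 1)) = 0 := by
    rcases Nat.lt_or_ge (j + 1) N with h3 | h3
    · have := hS (j + 1)
      exact coeff_eq_zero_of_natDegree_lt (by omega)
    · rw [show j + 1 = N by omega, tailSum_self, coeff_zero]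
  rw [hq.eq_mul j h1 h2, sub_mul, one_mul, coeff_sub,
    coeff_eq_zero_of_natDegree_lt (p := columnSum N h q j) (by omega), sub_zero,
    show N - j = N - (j + 1) + 1 by omega, coeff_X_mul, columnSum, finsetSum_coeff,
    sum_eq_single_of_mem j (by simpa using h2)]
  · rw [tailSum_eq_add q h2, coeff_smul, coeff_add, hz, add_zero, smul_eq_mul]
  · intro i hi hij
    rw [mem_Ico] at hi
    rw [coeff_smul, coeff_eq_zero_of_natDegree_lt, smul_zero]
    have := hS i
    omega

/-- The step sizes can be read off from the family, because the tail sums `S_i` have distinct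
degrees. -/
theorem IsGenerated.step_unique {N : ℕ} {h h' : ℕ → ℕ → ℝ} {q : ℕ → ℝ[X]}
    (hq : IsGenerated N h q) (hq' : IsGenerated N h' q)
    (hne : ∀ j, 1 ≤ j → j ≤ N → (q j).coeff (N - j) ≠ 0) {i j : ℕ} (h1 : 1 ≤ j) (h2 : j ≤ i)
    (h3 : i < N) : h i j = h' i j := by
  have hS : ∀ i, (tailSum N q i).natDegree ≤ N - 1 - i := fun i =>
    natDegree_tailSum_le fun k hk => hq.natDegree_le (by omega)
  have hlead : ∀ i < N, (tailSum N q i).coeff (N - 1 - i) ≠ 0 := by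
    intro i hi
    rw [tailSum_eq_add q hi, coeff_add, show N - 1 - i = N - (i + 1) by omega]
    have hz : (tailSum N q (i + 1)).coeff (N - (i + 1)) = 0 := by
      rcases Nat.lt_or_ge (i + 1) N with h3 | h3
      · have := hS (i + 1)
        exact coeff_eq_zero_of_natDegree_lt (by omega)
      · rw [show i + 1 = N by omega, tailSum_self, coeff_zero]
    rw [hz, add_zero]
    exact hne (i + 1) (by omega) (by omega)
  have heq : ∑ l ∈ Ico j N, (h l j - h' l j) • tailSum N q l = 0 := by
    have hX : (X - 1 : ℝ[X]) ≠ 0 := by simpa using X_sub_C_ne_zero (1 : ℝ)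
    have := mul_left_cancel₀ hX
      ((hq.eq_mul j h1 (by omega)).symm.trans (hq'.eq_mul j h1 (by omega)))
    simp only [sub_smul, sum_sub_distrib]
    exact sub_eq_zero.2 this
  induction i using Nat.strong_induction_on with
  | _ i ih =>
    have hc := congrArg (fun p => coeff p (N - 1 - i)) heq
    simp only [finsetSum_coeff, coeff_smul, coeff_zero, smul_eq_mul] at hc
    rw [sum_eq_single_of_mem i (by rw [mem_Ico]; omega)] at hc
    · exact sub_eq_zero.1 ((mul_eq_zero.1 hc).resolve_right (hlead i h3))
    · intro l hl hli
      rw [mem_Ico] at hl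
      rcases Nat.lt_or_ge l i with h4 | h4
      · rw [ih l h4 hl.1 hl.2, sub_self, zero_mul]
      · have := hS l
        rw [coeff_eq_zero_of_natDegree_lt (by omega), mul_zero]

/-! ### Abel summation along the iterates -/

/-- For iterates `y` with residuals `u`, the sum `∑ φ(q_j) y_{j-1}` depends on the starting point
and the residuals only.  Both `φ = coeff n` and evaluation at a linear operator are used. -/
theorem sum_apply_iterate {N : ℕ} (hN : 1 ≤ N) {h : ℕ → ℕ → ℝ} (q : ℕ → ℝ[X]) {E : Type*}
    [AddCommGroup E] [Module ℝ E] (φ : ℝ[X] →ₗ[ℝ] E →ₗ[ℝ] E) {y u : ℕ → E}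
    (hy : ∀ k, 1 ≤ k → k < N → y k = y (k - 1) - ∑ j ∈ Icc 1 k, h k j • u j) :
    ∑ j ∈ Icc 1 N, φ (q j) (y (j - 1))
      = φ (tailSum N q 0) (y 0) - ∑ j ∈ Ico 1 N, φ (columnSum N h q j) (u j) := by
  have key : ∀ M, 1 ≤ M → M ≤ N →
      ∑ j ∈ Icc 1 M, φ (q j) (y (j - 1)) + φ (tailSum N q M) (y (M - 1))
        = φ (tailSum N q 0) (y 0) + ∑ l ∈ Ico 1 M, φ (tailSum N q l) (y l - y (l - 1)) := by
    intro M hM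
    induction M, hM using Nat.le_induction with
    | base =>
      intro _
      rw [tailSum_eq_add (i := 0) q (by omega)]
      simp
    | succ M hM ih =>
      intro hM'
      have := ih (by omega)
      rw [← insert_Icc_right_eq_Icc_add_one (by omega), sum_insert (by simp),
        sum_Ico_succ_top hM, ← add_assoc, ← this, tailSum_eq_add q (show M < N by omega)]
      simp only [map_add, LinearMap.add_apply, map_sub, Nat.add_sub_cancel]
      abel
  have h0 := key N hN le_rfl
  rw [tailSum_self, map_zero, LinearMap.zero_apply, add_zero] at h0
  rw [h0, sub_eq_add_neg, ← sum_neg_distrib]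
  congr 1
  have h1 : ∀ l ∈ Ico 1 N, φ (tailSum N q l) (y l - y (l - 1))
      = ∑ j ∈ Icc 1 l, -(h l j • φ (tailSum N q l) (u j)) := by
    intro l hl
    rw [mem_Ico] at hl
    rw [hy l hl.1 hl.2, sub_sub_cancel_left, map_neg, map_sum, sum_neg_distrib]
    simp only [map_smul]
  rw [sum_congr rfl h1, sum_comm' (t' := Ico 1 N) (s' := fun j => Ico j N)]
  · refine sum_congr rfl fun j _ => ?_
    rw [columnSum, map_sum, LinearMap.sum_apply, sum_neg_distrib]
    simp
  · intro l j
    simp only [mem_Ico, mem_Icc]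
    omega

/-! ### The optimal rate for invariant families with nonpositive inner products -/

/-- A weighted sum of nonnegative interactions, arranged by the row sums of the weight matrix. -/
theorem sum_gram_ge {ι E : Type*} [NormedAddCommGroup E] [InnerProductSpace ℝ E] (s : Finset ι)
    (g : ι → ι → ℝ) (hsymm : ∀ i j, g i j = g j i) (z u : ι → E)
    (hg : ∀ i ∈ s, ∀ j ∈ s, i ≠ j → g i j ≤ 0)
    (hmono : ∀ i ∈ s, ∀ j ∈ s, 0 ≤ inner ℝ (z i - z j) (u i - u j)) :
    ∑ i ∈ s, (∑ j ∈ s, g i j) * inner ℝ (z i) (u i)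
      ≤ ∑ i ∈ s, ∑ j ∈ s, g i j * inner ℝ (z i) (u j) := by
  have h0 : ∑ i ∈ s, ∑ j ∈ s, g i j * inner ℝ (z i - z j) (u i - u j) ≤ 0 := by
    refine sum_nonpos fun i hi => sum_nonpos fun j hj => ?_
    by_cases hij : i = j
    · subst hij; simp
    · exact mul_nonpos_of_nonpos_of_nonneg (hg i hi j hj hij) (hmono i hi j hj)
  have h1 : ∑ i ∈ s, ∑ j ∈ s, g i j * inner ℝ (z i - z j) (u i - u j)
      = 2 * ∑ i ∈ s, (∑ j ∈ s, g i j) * inner ℝ (z i) (u i)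
        - 2 * ∑ i ∈ s, ∑ j ∈ s, g i j * inner ℝ (z i) (u j) := by
    have ha : ∑ i ∈ s, ∑ j ∈ s, g i j * inner ℝ (z j) (u j)
        = ∑ i ∈ s, ∑ j ∈ s, g i j * inner ℝ (z i) (u i) := by
      rw [sum_comm]
      exact sum_congr rfl fun i _ => sum_congr rfl fun j _ => by rw [hsymm]
    have hb : ∑ i ∈ s, ∑ j ∈ s, g i j * inner ℝ (z j) (u i)
        = ∑ i ∈ s, ∑ j ∈ s, g i j * inner ℝ (z i) (u j) := by
      rw [sum_comm]
      exact sum_congr rfl fun i _ => sum_congr rfl fun j _ => by rw [hsymm]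
    have hc : ∀ i j, g i j * inner ℝ (z i - z j) (u i - u j)
        = g i j * inner ℝ (z i) (u i) - g i j * inner ℝ (z i) (u j)
          - g i j * inner ℝ (z j) (u i) + g i j * inner ℝ (z j) (u j) := by
      intro i j
      rw [inner_sub_left, inner_sub_right, inner_sub_right]
      ring
    simp only [hc, sum_add_distrib, sum_sub_distrib, ha, hb, sum_mul]
    ring
  linarith

/-- The telescoping sum behind the rate: with `U` and `Z` the coefficient vectors of
`(X - 1) Φ + w` and `2 c - (X + 1) Φ - w`. -/
theorem sum_inner_telescope {E : Type*} [NormedAddCommGroup E] [InnerProductSpace ℝ E]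
    (Φ U Z : ℕ → E) (w c : E) (hU0 : U 0 = w - Φ 0) (hU : ∀ n, U (n + 1) = Φ n - Φ (n + 1))
    {N : ℕ} (hZ : ∀ n < N, Z n = (2 : ℝ) • c - (2 : ℝ) • Φ n - U n) (hN : 1 ≤ N)
    (hΦ : Φ (N - 1) = 0) :
    ∑ n ∈ range N, inner ℝ (Z n) (U n) = 2 * inner ℝ c w - ‖w‖ ^ 2 := by
  have key : ∀ M, M < N → ∑ n ∈ range (M + 1), inner ℝ (Z n) (U n)
      = 2 * inner ℝ c (w - Φ M) - (‖w‖ ^ 2 - ‖Φ M‖ ^ 2) := by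
    intro M
    induction M with
    | zero =>
      intro h
      rw [sum_range_one, hZ 0 h, hU0]
      simp only [← real_inner_self_eq_norm_sq, inner_sub_left, inner_sub_right,
        real_inner_smul_left, real_inner_comm w (Φ 0)]
      ring
    | succ M ih =>
      intro h
      rw [sum_range_succ, ih (by omega), hZ _ h, hU]
      simp only [← real_inner_self_eq_norm_sq, inner_sub_left, inner_sub_right,
        real_inner_smul_left, real_inner_comm (Φ (M + 1)) (Φ M)]
      ring
  have := key (N - 1) (by omega)
  rw [Nat.sub_add_cancel hN] at this
  rw [this, hΦ]
  simp

/-- Sufficiency: the invariants together with nonpositive inner products give the optimal rate. The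
inequalities of `T` between the iterates `j`, `k` enter with the weights `-⟨q j, q k⟩`. -/
theorem IsGenerated.norm_residual_le {N : ℕ} (hN : 1 ≤ N) {h : ℕ → ℕ → ℝ} {q : ℕ → ℝ[X]}
    (hq : IsGenerated N h q) (hsum : tailSum N q 0 = (1 / N : ℝ) • geom N)
    (hneg : ∀ j k, 1 ≤ j → j < k → k ≤ N → coeffDot (q j) (q k) ≤ 0)
    {E : Type*} [NormedAddCommGroup E] [InnerProductSpace ℝ E] {T : E → E}
    (hT : ∀ x x', ‖T x - T x'‖ ≤ ‖x - x'‖) {p : E} (hp : T p = p) {y : ℕ → E}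
    (hy : ∀ k, 1 ≤ k → k < N →
      y k = y (k - 1) - ∑ j ∈ Icc 1 k, h k j • (y (j - 1) - T (y (j - 1)))) :
    ‖y (N - 1) - T (y (N - 1))‖ ^ 2 ≤ 4 * ‖y 0 - p‖ ^ 2 / (N : ℝ) ^ 2 := by
  have hN0 : (0 : ℝ) < N := by exact_mod_cast hN
  set u : ℕ → E := fun j => y (j - 1) - T (y (j - 1)) with hu
  set z : ℕ → E := fun j => (2 : ℝ) • y (j - 1) - u j with hz
  have hmem : ∀ {j}, j ∈ Icc 1 N → 1 ≤ j ∧ j ≤ N := fun hj => by simpa using hj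
  -- nonexpansiveness of `T` is monotonicity of `y + T y` in `y - T y`
  have hmono : ∀ a b : E, 0 ≤ inner ℝ (((2 : ℝ) • a - (a - T a)) - ((2 : ℝ) • b - (b - T b)))
      ((a - T a) - (b - T b)) := by
    intro a b
    have h1 : ((2 : ℝ) • a - (a - T a)) - ((2 : ℝ) • b - (b - T b))
        = (a - b) + (T a - T b) := by rw [two_smul, two_smul]; abel
    have h2 : (a - T a) - (b - T b) = (a - b) - (T a - T b) := by abel
    have h3 : ∀ v w : E, inner ℝ (v + w) (v - w) = ‖v‖ ^ 2 - ‖w‖ ^ 2 := fun v w => by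
      rw [inner_add_left, inner_sub_right, inner_sub_right, real_inner_self_eq_norm_sq,
        real_inner_self_eq_norm_sq, real_inner_comm v w]
      ring
    rw [h1, h2, h3]
    have := pow_le_pow_left₀ (norm_nonneg _) (hT a b) 2
    linarith
  -- the rows `j < N` of the Gram matrix sum to zero because `q j` vanishes at `1`
  have hrow : ∀ j ∈ Icc 1 N,
      ∑ k ∈ Icc 1 N, coeffDot (q j) (q k) = if j = N then (1 / N : ℝ) else 0 := by
    intro j hj
    have hj := hmem hj
    have : ∑ k ∈ Icc 1 N, coeffDot (q j) (q k) = coeffDot (q j) (tailSum N q 0) := by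
      rw [tailSum, map_sum]
      rfl
    rw [this, hsum, map_smul, coeffDot_geom (by have := hq.natDegree_le hj.1 hj.2; omega)]
    split_ifs with h1
    · rw [h1, hq.last]; simp
    · rw [hq.eval_one hj.1 (by omega)]; simp
  have hlow := sum_gram_ge (Icc 1 N) (fun j k => coeffDot (q j) (q k))
    (fun _ _ => coeffDot_comm _ _) z u
    (fun i hi j hj hij => by
      have hi := hmem hi
      have hj := hmem hj
      rcases lt_or_gt_of_ne hij with h1 | h1
      · exact hneg i j hi.1 h1 hj.2
      · exact (coeffDot_comm _ _).trans_le (hneg j i hj.1 h1 hi.2))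
    (fun i _ j _ => hmono _ _)
  rw [sum_congr rfl fun j hj => by rw [hrow j hj]] at hlow
  simp only [ite_mul, zero_mul, sum_ite_eq', right_mem_Icc, hN, if_true] at hlow
  -- the Gram sum is the inner product of the coefficient vectors of `∑ q j z_j` and `∑ q j u_j`
  have hgram : ∑ i ∈ Icc 1 N, ∑ j ∈ Icc 1 N, coeffDot (q i) (q j) * inner ℝ (z i) (u j)
      = ∑ n ∈ range N, inner ℝ (∑ i ∈ Icc 1 N, (q i).coeff n • z i)
          (∑ j ∈ Icc 1 N, (q j).coeff n • u j) := by
    simp only [sum_inner, inner_sum, real_inner_smul_left, real_inner_smul_right]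
    rw [sum_comm, sum_comm (s := range N)]
    refine sum_congr rfl fun j _ => ?_
    rw [sum_comm (s := range N)]
    refine sum_congr rfl fun i hi => ?_
    have hi := hmem hi
    rw [coeffDot_eq_sum (M := N) (by have := hq.natDegree_le hi.1 hi.2; omega), sum_mul]
    refine sum_congr rfl fun n _ => ?_
    ring
  set Φ : ℕ → E := fun n => ∑ j ∈ Ico 1 N, (columnSum N h q j).coeff n • u j with hΦ
  have hsplit : ∀ n, ∑ j ∈ Icc 1 N, (q j).coeff n • u j
      = ∑ j ∈ Ico 1 N, (q j).coeff n • u j + (q N).coeff n • u N := by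
    intro n
    rw [← Ico_insert_right hN, sum_insert (by simp), add_comm]
  have hcoeff : ∀ j ∈ Ico 1 N, q j = X * columnSum N h q j - columnSum N h q j := by
    intro j hj
    rw [mem_Ico] at hj
    rw [hq.eq_mul j hj.1 hj.2, sub_mul, one_mul]
  have htel := sum_inner_telescope Φ (fun n => ∑ j ∈ Icc 1 N, (q j).coeff n • u j)
    (fun n => ∑ i ∈ Icc 1 N, (q i).coeff n • z i) (u N) ((1 / N : ℝ) • y 0)
    (by
      rw [hsplit, hq.last, sum_congr rfl fun j hj => by rw [hcoeff j hj]]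
      simp [hΦ, add_comm, sub_eq_add_neg])
    (fun n => by
      rw [hsplit, hq.last, sum_congr rfl fun j hj => by rw [hcoeff j hj]]
      simp [hΦ, coeff_one, sub_smul, sum_sub_distrib])
    (N := N)
    (fun n hn => by
      let φ : ℝ[X] →ₗ[ℝ] E →ₗ[ℝ] E := (LinearMap.lsmul ℝ E).comp (lcoeff ℝ n)
      have hφ : ∀ r v, φ r v = r.coeff n • v := fun r v => rfl
      have := sum_apply_iterate hN q φ (y := y) (u := u) hy
      simp only [hφ, hsum, coeff_smul, coeff_geom, hn, if_true, smul_eq_mul, mul_one] at this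
      simp only [hz, smul_sub, sum_sub_distrib]
      rw [← smul_sub, ← this, smul_sum]
      simp only [smul_comm (2 : ℝ)])
    hN
    (by
      refine sum_eq_zero fun j hj => ?_
      rw [mem_Ico] at hj
      have := natDegree_columnSum_le (N := N) h (q := q) (j := j) fun k hk =>
        hq.natDegree_le (by omega)
      rw [coeff_eq_zero_of_natDegree_lt (by omega), zero_smul])
  rw [hgram, htel] at hlow
  have hfix : 0 ≤ inner ℝ (z N - (2 : ℝ) • p) (u N) := by
    have := hmono (y (N - 1)) p
    rwa [hp, sub_self, sub_zero, sub_zero] at this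
  have h1 : inner ℝ (z N) (u N) * (1 / N) + ‖u N‖ ^ 2 ≤ 2 / N * inner ℝ (y 0) (u N) := by
    rw [real_inner_smul_left] at hlow
    ring_nf at hlow ⊢
    linarith
  have h2 : N * ‖u N‖ ^ 2 ≤ 2 * inner ℝ (y 0 - p) (u N) := by
    rw [inner_sub_left, real_inner_smul_left] at hfix
    rw [inner_sub_left]
    field_simp at h1
    nlinarith
  have h3 : N * ‖u N‖ ^ 2 ≤ 2 * ‖y 0 - p‖ * ‖u N‖ := by
    have := real_inner_le_norm (y 0 - p) (u N)
    linarith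
  have h4 : N * ‖u N‖ ≤ 2 * ‖y 0 - p‖ := by
    rcases (norm_nonneg (u N)).eq_or_lt with h5 | h5
    · rw [← h5]; simp
    · refine le_of_mul_le_mul_right ?_ h5
      linarith
  rw [le_div_iff₀ (by positivity)]
  have := pow_le_pow_left₀ (by positivity) h4 2
  simp only [mul_pow] at this
  change ‖u N‖ ^ 2 * (N : ℝ) ^ 2 ≤ _
  linarith

/-! ### Necessity of the invariants: the signed cyclic shift -/

/-- The isometry `e₀ ↦ e₁ ↦ ⋯ ↦ eₙ ↦ -e₀` of `ℝⁿ⁺¹`. -/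
def signedShift (n : ℕ) : EuclideanSpace ℝ (Fin (n + 1)) →ₗ[ℝ] EuclideanSpace ℝ (Fin (n + 1)) where
  toFun v := WithLp.toLp 2 (Fin.cons (-v (Fin.last n)) fun i : Fin n => v i.castSucc)
  map_add' v w := by
    ext i
    refine Fin.cases ?_ (fun i => ?_) i <;> simp [add_comm]
  map_smul' c v := by
    ext i
    refine Fin.cases ?_ (fun i => ?_) i <;> simp

theorem signedShift_zero {n : ℕ} (v : EuclideanSpace ℝ (Fin (n + 1))) :
    signedShift n v 0 = -v (Fin.last n) := rfl

theorem signedShift_succ {n : ℕ} (v : EuclideanSpace ℝ (Fin (n + 1))) (i : Fin n) :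
    signedShift n v i.succ = v i.castSucc := rfl

theorem norm_signedShift {n : ℕ} (v : EuclideanSpace ℝ (Fin (n + 1))) :
    ‖signedShift n v‖ = ‖v‖ := by
  rw [EuclideanSpace.norm_eq, EuclideanSpace.norm_eq, Fin.sum_univ_succ, Fin.sum_univ_castSucc,
    add_comm]
  simp [signedShift_zero, signedShift_succ]

theorem signedShift_pow_single {n k : ℕ} (hk : k < n + 1) :
    (signedShift n ^ k) (EuclideanSpace.single 0 1) = EuclideanSpace.single ⟨k, hk⟩ 1 := by
  induction k with
  | zero => rfl
  | succ k ih =>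
    rw [pow_succ', Module.End.mul_apply, ih (by omega)]
    ext i
    refine Fin.cases ?_ (fun i => ?_) i
    · rw [signedShift_zero]
      simp [Fin.ext_iff]
      omega
    · rw [signedShift_succ]
      simp [Fin.ext_iff]

theorem aeval_signedShift_single {n : ℕ} {p : ℝ[X]} (hp : p.natDegree < n + 1) (i : Fin (n + 1)) :
    (aeval (signedShift n) p) (EuclideanSpace.single 0 1) i = p.coeff i := by
  rw [aeval_eq_sum_range' hp, LinearMap.sum_apply]
  have : ∀ k ∈ range (n + 1), (p.coeff k • signedShift n ^ k) (EuclideanSpace.single 0 1)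
      = if h : k < n + 1 then EuclideanSpace.single ⟨k, h⟩ (p.coeff k) else 0 := by
    intro k hk
    rw [mem_range] at hk
    rw [dif_pos hk, LinearMap.smul_apply, signedShift_pow_single hk]
    ext l
    simp
  rw [sum_congr rfl this, Finset.sum_range]
  simp only [Fin.is_lt, dif_pos, Fin.eta, WithLp.ofLp_sum, Finset.sum_apply]
  simp

theorem signedShift_ones (n : ℕ) :
    WithLp.toLp 2 (fun _ => 1) - signedShift n (WithLp.toLp 2 fun _ => 1)
      = (2 : ℝ) • EuclideanSpace.single (0 : Fin (n + 1)) (1 : ℝ) := by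
  ext i
  refine Fin.cases ?_ (fun i => ?_) i
  · rw [PiLp.sub_apply, signedShift_zero]
    norm_num
  · simp [signedShift_succ]

/-- Among the vectors whose coordinates sum to one, only the constant one has norm `1 / √N`. -/
theorem eq_const_of_sum_sq_le {N : ℕ} (hN : 1 ≤ N) {c : ℕ → ℝ} (h1 : ∑ i ∈ range N, c i = 1)
    (h2 : ∑ i ∈ range N, c i ^ 2 ≤ 1 / N) {i : ℕ} (hi : i < N) : c i = 1 / N := by
  have hN0 : (0 : ℝ) < N := by exact_mod_cast hN
  have h3 : ∑ i ∈ range N, (c i - 1 / N) ^ 2 = ∑ i ∈ range N, c i ^ 2 - 1 / N := by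
    have : ∀ i, (c i - 1 / N) ^ 2 = c i ^ 2 - 2 / N * c i + 1 / N ^ 2 := fun i => by ring
    simp only [this, sum_add_distrib, sum_sub_distrib, ← mul_sum, h1, sum_const, card_range,
      nsmul_eq_mul]
    field_simp
    ring
  have h4 := (sum_eq_zero_iff_of_nonneg fun i _ => sq_nonneg (c i - 1 / N)).1
    (le_antisymm (h3.trans_le (sub_nonpos.2 h2)) (sum_nonneg fun i _ => sq_nonneg (c i - 1 / N)))
    i (by simpa using hi)
  exact sub_eq_zero.1 (pow_eq_zero_iff two_ne_zero |>.1 h4)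

/-- The iterates of a linear operator: `y_{N-1} = S₀(T) y₀`. -/
theorem IsGenerated.iterate_eq_aeval {N : ℕ} (hN : 1 ≤ N) {h : ℕ → ℕ → ℝ} {q : ℕ → ℝ[X]}
    (hq : IsGenerated N h q) {E : Type*} [AddCommGroup E] [Module ℝ E] (T : E →ₗ[ℝ] E) {y : ℕ → E}
    (hy : ∀ k, 1 ≤ k → k < N →
      y k = y (k - 1) - ∑ j ∈ Icc 1 k, h k j • (y (j - 1) - T (y (j - 1)))) :
    y (N - 1) = aeval T (tailSum N q 0) (y 0) := by
  have := sum_apply_iterate hN q (aeval T).toLinearMap (u := fun j => y (j - 1) - T (y (j - 1))) hy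
  simp only [AlgHom.toLinearMap_apply] at this
  rw [← Ico_insert_right hN, sum_insert (by simp), hq.last, map_one, Module.End.one_apply] at this
  have h1 : ∀ j ∈ Ico 1 N, aeval T (q j) (y (j - 1))
      = -aeval T (columnSum N h q j) (y (j - 1) - T (y (j - 1))) := by
    intro j hj
    rw [mem_Ico] at hj
    rw [hq.eq_mul j hj.1 hj.2, mul_comm, map_mul, Module.End.mul_apply, ← map_neg]
    simp
  rw [sum_congr rfl h1, sum_neg_distrib, ← sub_eq_add_neg] at this
  exact sub_left_injective this

theorem IsGenerated.eval_one_tailSum {N : ℕ} {h : ℕ → ℕ → ℝ} {q : ℕ → ℝ[X]}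
    (hq : IsGenerated N h q) {i : ℕ} (hi : i < N) : (tailSum N q i).eval 1 = 1 := by
  rw [tailSum, eval_finsetSum, sum_eq_single_of_mem N (by simpa using hi)]
  · rw [hq.last, Polynomial.eval_one]
  · intro k hk hkN
    rw [mem_Ioc] at hk
    exact hq.eval_one (by omega) (by omega)

theorem sum_Icc_one_eq_sum_range {M : Type*} [AddCommMonoid M] (f : ℕ → M) (k : ℕ) :
    ∑ j ∈ Icc 1 k, f j = ∑ j ∈ range k, f (j + 1) := by
  rw [range_eq_Ico, sum_Ico_add' f 0 k 1]
  rfl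

/-- The iterates with step sizes `h` on the operator `T` from the starting point `y₀`. -/
def iterates (h : ℕ → ℕ → ℝ) {E : Type*} [AddCommGroup E] [Module ℝ E] (T : E → E) (y₀ : E) :
    ℕ → E
  | 0 => y₀
  | k + 1 => iterates h T y₀ k -
      ∑ j : Fin (k + 1), h (k + 1) (j + 1) • (iterates h T y₀ j - T (iterates h T y₀ j))

theorem iterates_eq (h : ℕ → ℕ → ℝ) {E : Type*} [AddCommGroup E] [Module ℝ E] (T : E → E) (y₀ : E)
    {k : ℕ} (hk : 1 ≤ k) :
    iterates h T y₀ k = iterates h T y₀ (k - 1) -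
      ∑ j ∈ Icc 1 k, h k j • (iterates h T y₀ (j - 1) - T (iterates h T y₀ (j - 1))) := by
  obtain ⟨k, rfl⟩ : ∃ l, k = l + 1 := ⟨k - 1, by omega⟩
  rw [iterates, sum_Icc_one_eq_sum_range, Finset.sum_range]
  simp

/-- The optimal rate on the signed cyclic shift forces the invariants of the step sizes. -/
theorem IsGenerated.tailSum_eq_geom {N : ℕ} (hN : 1 ≤ N) {h : ℕ → ℕ → ℝ} {q : ℕ → ℝ[X]}
    (hq : IsGenerated N h q)
    (hrate : ∀ (T : EuclideanSpace ℝ (Fin (N - 1 + 1)) → EuclideanSpace ℝ (Fin (N - 1 + 1))),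
      (∀ x x', ‖T x - T x'‖ ≤ ‖x - x'‖) → T 0 = 0 →
      ∀ y : ℕ → EuclideanSpace ℝ (Fin (N - 1 + 1)), (∀ k, 1 ≤ k → k < N →
        y k = y (k - 1) - ∑ j ∈ Icc 1 k, h k j • (y (j - 1) - T (y (j - 1)))) →
      ‖y (N - 1) - T (y (N - 1))‖ ^ 2 ≤ 4 * ‖y 0‖ ^ 2 / (N : ℝ) ^ 2) :
    tailSum N q 0 = (1 / N : ℝ) • geom N := by
  obtain ⟨n, rfl⟩ : ∃ n, N = n + 1 := ⟨N - 1, by omega⟩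
  simp only [Nat.add_sub_cancel] at hrate
  have hdeg : (tailSum (n + 1) q 0).natDegree < n + 1 := by
    have := natDegree_tailSum_le (N := n + 1) (q := q) (i := 0) fun k hk => hq.natDegree_le hk
    omega
  set T := signedShift n
  set y0 : EuclideanSpace ℝ (Fin (n + 1)) := WithLp.toLp 2 fun _ => 1
  set y := iterates h T y0
  have hy : ∀ k, 1 ≤ k →
      y k = y (k - 1) - ∑ j ∈ Icc 1 k, h k j • (y (j - 1) - T (y (j - 1))) := fun k hk =>
    iterates_eq h T y0 hk
  have hy0 : y 0 = y0 := by simp [y, iterates]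
  have hr : ‖y n - T (y n)‖ ^ 2 ≤ 4 * ‖y 0‖ ^ 2 / ((n + 1 : ℕ) : ℝ) ^ 2 := hrate T
    (fun x x' => by rw [← map_sub, norm_signedShift]) (map_zero T) y fun k hk _ => hy k hk
  have hlast := hq.iterate_eq_aeval hN T fun k hk _ => hy k hk
  rw [Nat.add_sub_cancel] at hlast
  rw [hlast, hy0] at hr
  -- `(1 - T) 1 = 2 e₀`, and `S₀(T) e₀` lists the coefficients of `S₀`
  have hcomm : aeval T (tailSum (n + 1) q 0) y0 - T (aeval T (tailSum (n + 1) q 0) y0)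
      = (2 : ℝ) • aeval T (tailSum (n + 1) q 0) (EuclideanSpace.single 0 1) := by
    rw [← map_smul, ← signedShift_ones, map_sub]
    congr 1
    have := congrArg (fun p => aeval T p y0) (mul_comm X (tailSum (n + 1) q 0))
    simpa using this
  rw [hcomm, norm_smul, mul_pow, EuclideanSpace.norm_sq_eq, EuclideanSpace.norm_sq_eq] at hr
  have hcoord : ∀ i : Fin (n + 1), (aeval T (tailSum (n + 1) q 0)) (EuclideanSpace.single 0 1) i
      = (tailSum (n + 1) q 0).coeff i := aeval_signedShift_single hdeg
  simp only [hcoord, Real.norm_eq_abs, sq_abs] at hr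
  have hsq : ∑ i ∈ range (n + 1), (tailSum (n + 1) q 0).coeff i ^ 2 ≤ 1 / ((n + 1 : ℕ) : ℝ) := by
    rw [Finset.sum_range]
    simp [y0] at hr
    push_cast
    rw [le_div_iff₀ (by positivity)] at hr ⊢
    have hn : (0 : ℝ) < n + 1 := by positivity
    refine le_of_mul_le_mul_right ?_ hn
    linarith
  ext i
  rw [coeff_smul, coeff_geom]
  split_ifs with hi
  · rw [smul_eq_mul, mul_one]
    refine eq_const_of_sum_sq_le hN (c := (tailSum (n + 1) q 0).coeff) ?_ hsq hi
    have := hq.eval_one_tailSum (i := 0) (by omega)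
    rw [eval_eq_sum_range' hdeg] at this
    simpa using this
  · rw [smul_zero]
    exact coeff_eq_zero_of_natDegree_lt (by omega)

/-! ### Chains, Q-functions and certificates -/

theorem mem_chains {N m j : ℕ} {c : Fin m → ℕ × ℕ} :
    c ∈ chains N m j ↔ (∀ r, (1 ≤ (c r).1 ∧ (c r).1 ≤ N - 1) ∧ 1 ≤ (c r).2 ∧ (c r).2 ≤ N - 1) ∧
      (∀ r : Fin m, r.val = 0 → (c r).2 = j) ∧ (∀ r : Fin m, (c r).2 ≤ (c r).1) ∧
      ∀ r s : Fin m, r.val + 1 = s.val → (c r).1 < (c s).2 := by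
  simp [chains]

theorem cons_mem_chains {N m j : ℕ} {a : ℕ × ℕ} {c : Fin (m + 1) → ℕ × ℕ} :
    (Fin.cons a c : Fin (m + 2) → ℕ × ℕ) ∈ chains N (m + 2) j ↔
      a.2 = j ∧ 1 ≤ a.2 ∧ a.2 ≤ a.1 ∧ a.1 < (c 0).2 ∧ c ∈ chains N (m + 1) (c 0).2 := by
  rw [mem_chains, mem_chains]
  constructor
  · rintro ⟨h1, h2, h3, h4⟩
    refine ⟨h2 0 rfl, (h1 0).2.1, h3 0, h4 0 1 rfl, fun r => h1 r.succ, ?_, fun r => h3 r.succ, ?_⟩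
    · intro r hr
      rw [show r = 0 from Fin.ext hr]
    · intro r s hrs
      exact h4 r.succ s.succ (by simpa using hrs)
  · rintro ⟨h1, h2, h3, h4, h5, -, h6, h7⟩
    have h8 := h5 0
    have h9 := h6 0
    refine ⟨Fin.cases (by simp only [Fin.cons_zero]; omega) fun r => h5 r, ?_,
      Fin.cases h3 fun r => h6 r, ?_⟩
    · intro r hr
      rw [show r = 0 from Fin.ext hr]
      exact h1
    · intro r s hrs
      obtain ⟨s, rfl⟩ := Fin.exists_succ_eq.2 (show s ≠ 0 by rintro rfl; simp at hrs)
      refine Fin.cases (fun hrs => ?_) (fun r hrs => ?_) r hrs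
      · have hs : s = 0 := Fin.ext (by simpa using hrs.symm)
        rw [hs]
        exact h4
      · exact h7 r s (by simpa using hrs)

theorem qFun_one {N : ℕ} (H : HMatrix N) {j : ℕ} (hj : 1 ≤ j) :
    qFun H 1 j = ∑ i ∈ Ico j N, entry H i j := by
  rw [qFun]
  refine sum_bij' (fun c _ => (c 0).1) (fun i _ _ => (i, j)) ?_ ?_ ?_ ?_ ?_
  · intro c hc
    rw [mem_chains] at hc
    have h1 := hc.1 0
    have h2 := hc.2.1 0 rfl
    have h3 := hc.2.2.1 0
    rw [mem_Ico]
    omega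
  · intro i hi
    rw [mem_Ico] at hi
    rw [mem_chains]
    refine ⟨fun r => ?_, fun _ _ => rfl, fun r => hi.1, fun r s hrs => ?_⟩
    · simp only
      omega
    · omega
  · intro c hc
    rw [mem_chains] at hc
    funext r
    rw [Subsingleton.elim r 0, ← hc.2.1 0 rfl]
  · intro i hi
    rfl
  · intro c hc
    rw [mem_chains] at hc
    rw [Fin.prod_univ_one, hc.2.1 0 rfl]

/-- Splitting off the first pair of a chain. -/
theorem qFun_succ_succ {N : ℕ} (H : HMatrix N) (m : ℕ) {j : ℕ} (hj : 1 ≤ j) :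
    qFun H (m + 2) j = ∑ i ∈ Ico j N, entry H i j * ∑ k ∈ Ioo i N, qFun H (m + 1) k := by
  simp only [qFun, mul_sum]
  rw [sum_sigma', sum_sigma']
  refine sum_bij' (fun c _ => ⟨⟨(c 0).1, (c 1).2⟩, Fin.tail c⟩)
    (fun x _ => Fin.cons (x.1.1, j) x.2) ?_ ?_ ?_ ?_ ?_
  · intro c hc
    rw [← Fin.cons_self_tail c, cons_mem_chains] at hc
    obtain ⟨h1, h2, h3, h4, h5⟩ := hc
    have h6 := (mem_chains.1 h5).1 0
    have h7 : (Fin.tail c 0).2 = (c 1).2 := rfl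
    rw [h7] at h4 h5 h6
    simp only [mem_sigma, mem_Ico, mem_Ioo]
    exact ⟨⟨by omega, by omega⟩, h5⟩
  · rintro ⟨⟨i, k⟩, c⟩ hx
    simp only [mem_sigma, mem_Ico, mem_Ioo] at hx
    have hk : (c 0).2 = k := (mem_chains.1 hx.2).2.1 0 rfl
    rw [cons_mem_chains, hk]
    exact ⟨rfl, hj, hx.1.1.1, hx.1.2.1, hx.2⟩
  · intro c hc
    rw [mem_chains] at hc
    rw [← hc.2.1 0 rfl]
    exact Fin.cons_self_tail c
  · rintro ⟨⟨i, k⟩, c⟩ hx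
    simp only [mem_sigma] at hx
    have hk : (c 0).2 = k := (mem_chains.1 hx.2).2.1 0 rfl
    have : (Fin.cons (i, j) c : Fin (m + 2) → ℕ × ℕ) 1 = c 0 := rfl
    simp only [Fin.cons_zero, Fin.tail_cons, this, hk]
  · intro c hc
    rw [mem_chains] at hc
    rw [Fin.prod_univ_succ, hc.2.1 0 rfl]
    rfl

/-- A chain of `m` pairs that starts at `j` has room only if `m ≤ N - j`. -/
theorem qFun_eq_zero {N : ℕ} (H : HMatrix N) {m j : ℕ} (hj : 1 ≤ j) (hm : 1 ≤ m)
    (h : N < m + j) : qFun H m j = 0 := by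
  induction m, hm using Nat.le_induction generalizing j with
  | base => rw [qFun_one H hj, Ico_eq_empty (by omega), sum_empty]
  | succ m hm ih =>
    obtain ⟨m, rfl⟩ : ∃ l, m = l + 1 := ⟨m - 1, by omega⟩
    rw [qFun_succ_succ H m hj]
    refine sum_eq_zero fun i hi => ?_
    rw [mem_Ico] at hi
    rw [sum_eq_zero, mul_zero]
    intro k hk
    rw [mem_Ioo] at hk
    exact ih (by omega) (by omega)

/-- The polynomials `∑ₘ Q(m, j; H) (X - 1) ^ m` for `j < N`, completed by `1` at `j = N`. -/
def qPoly {N : ℕ} (H : HMatrix N) (j : ℕ) : ℝ[X] :=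
  if j = N then 1 else ∑ m ∈ Icc 1 (N - 1), qFun H m j • (X - 1) ^ m

theorem qPoly_of_lt {N : ℕ} (H : HMatrix N) {j : ℕ} (hj : j < N) :
    qPoly H j = ∑ m ∈ Icc 1 (N - 1), qFun H m j • (X - 1) ^ m := if_neg hj.ne

theorem isGenerated_qPoly {N : ℕ} (H : HMatrix N) : IsGenerated N (entry H) (qPoly H) where
  last := if_pos rfl
  eq_mul := by
    intro j h1 h2
    have htail : ∀ i ∈ Ico j N, tailSum N (qPoly H) i
        = 1 + ∑ m ∈ range (N - 1), (∑ k ∈ Ioo i N, qFun H (m + 1) k) • (X - 1) ^ (m + 1) := by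
      intro i hi
      rw [mem_Ico] at hi
      rw [tailSum, ← Ioo_insert_right hi.2, sum_insert (by simp), qPoly, if_pos rfl,
        sum_congr rfl fun k hk => qPoly_of_lt H (mem_Ioo.1 hk).2]
      simp only [sum_Icc_one_eq_sum_range, sum_smul]
      rw [sum_comm]
    have hcol : (X - 1) * columnSum N (entry H) (qPoly H) j
        = ∑ m ∈ range (N - 1 + 1), qFun H (m + 1) j • (X - 1) ^ (m + 1) := by
      rw [columnSum, sum_congr rfl fun i hi => by rw [htail i hi], sum_range_succ', qFun_one H h1]
      simp only [smul_add, sum_add_distrib, mul_add, zero_add, pow_one, smul_sum,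
        qFun_succ_succ H _ h1, sum_smul, mul_sum, mul_smul]
      rw [add_comm, sum_comm]
      congr 1
      · refine sum_congr rfl fun m _ => sum_congr rfl fun i _ => ?_
        refine sum_congr rfl fun k _ => ?_
        rw [mul_smul_comm, mul_smul_comm, ← pow_succ']
      · refine sum_congr rfl fun i _ => ?_
        rw [mul_smul_comm, mul_one]
    rw [hcol, sum_range_succ, qFun_eq_zero H h1 (by omega) (by omega), zero_smul, add_zero,
      qPoly_of_lt H h2, sum_Icc_one_eq_sum_range]

/-- The certificates are the negatives of the off-diagonal Gram entries of the family `qPoly H`. -/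
theorem certificate_eq {N : ℕ} (H : HMatrix N) {j k : ℕ} (hjk : j < k) (hk : k ≤ N) :
    certificate H k j = -(N * coeffDot (qPoly H j) (qPoly H k)) := by
  rw [certificate]
  split_ifs with h
  · subst h
    rw [qPoly, qPoly, if_pos rfl, if_neg hjk.ne, coeffDot_one_right, coeff_zero_eq_eval_zero,
      eval_finsetSum, ← mul_neg, ← sum_neg_distrib]
    congr 1
    refine sum_congr rfl fun m hm => ?_
    rw [mem_Icc] at hm
    obtain ⟨m, rfl⟩ : ∃ l, m = l + 1 := ⟨m - 1, by omega⟩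
    simp [pow_succ]
    ring
  · rw [qPoly_of_lt H (by omega), qPoly_of_lt H (by omega), ← mul_neg]
    simp only [map_sum, map_smul, LinearMap.sum_apply, LinearMap.smul_apply,
      coeffDot_X_sub_one_pow, smul_eq_mul]
    rw [← sum_neg_distrib]
    congr 1
    rw [sum_comm]
    refine sum_congr rfl fun m hm => ?_
    rw [← mul_neg, ← sum_neg_distrib, mul_sum]
    refine sum_congr rfl fun l _ => ?_
    rw [mem_Icc] at hm
    obtain ⟨m, rfl⟩ : ∃ l, m = l + 1 := ⟨m - 1, by omega⟩
    rw [show l + (m + 1) - 1 = l + m by omega, ← add_assoc, pow_succ]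
    ring

theorem tailSum_congr {N : ℕ} {q r : ℕ → ℝ[X]} (hqr : ∀ j, 1 ≤ j → j ≤ N → q j = r j) (i : ℕ) :
    tailSum N q i = tailSum N r i :=
  sum_congr rfl fun k hk => by
    rw [mem_Ioc] at hk
    exact hqr k (by omega) hk.2

theorem IsGenerated.congr {N : ℕ} (hN : 1 ≤ N) {h h' : ℕ → ℕ → ℝ} {q r : ℕ → ℝ[X]}
    (hq : IsGenerated N h q) (hh : ∀ i j, 1 ≤ j → j ≤ i → i < N → h i j = h' i j)
    (hqr : ∀ j, 1 ≤ j → j ≤ N → q j = r j) : IsGenerated N h' r where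
  last := by rw [← hqr N hN le_rfl, hq.last]
  eq_mul := by
    intro j h1 h2
    rw [← hqr j h1 h2.le, hq.eq_mul j h1 h2]
    congr 1
    refine sum_congr rfl fun i hi => ?_
    rw [mem_Ico] at hi
    rw [hh i j h1 hi.1 hi.2, tailSum_congr hqr]

/-! ### Families with the orthogonality pattern of an arc diagram -/

/-- The family `q` has the shape of a family generated by optimal step sizes, and its members
`q j`, `q k` with `j < k` are orthogonal unless `(k, j)` is an arc of `G`. -/
structure Represents (G : ArcDiagram) (q : ℕ → ℝ[X]) : Prop where
  last : q G.nodes = 1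
  eval_one : ∀ j, 1 ≤ j → j < G.nodes → (q j).eval 1 = 0
  natDegree_le : ∀ j, 1 ≤ j → j ≤ G.nodes → (q j).natDegree ≤ G.nodes - j
  coeff_ne_zero : ∀ j, 1 ≤ j → j ≤ G.nodes → (q j).coeff (G.nodes - j) ≠ 0
  tailSum_zero : tailSum G.nodes q 0 = (1 / G.nodes : ℝ) • geom G.nodes
  dot_eq_zero : ∀ j k, 1 ≤ j → j < k → k ≤ G.nodes → G.target j ≠ k → coeffDot (q j) (q k) = 0

/-- For generated families the leading coefficients are automatically nonzero, since they multiply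
up to the leading coefficient of `q 1 + ⋯ + q N`. -/
theorem IsGenerated.represents {G : ArcDiagram} {h : ℕ → ℕ → ℝ} {q : ℕ → ℝ[X]}
    (hq : IsGenerated G.nodes h q) (hsum : tailSum G.nodes q 0 = (1 / G.nodes : ℝ) • geom G.nodes)
    (hdot : ∀ j k, 1 ≤ j → j < k → k ≤ G.nodes → G.target j ≠ k → coeffDot (q j) (q k) = 0) :
    Represents G q where
  last := hq.last
  eval_one := fun _ => hq.eval_one
  natDegree_le := fun _ => hq.natDegree_le
  coeff_ne_zero := by
    intro j h1
    have hN := G.nodes_pos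
    induction j, h1 using Nat.le_induction with
    | base =>
      intro _
      have h2 := congrArg (fun p => coeff p (G.nodes - 1)) hsum
      have h3 := natDegree_tailSum_le (N := G.nodes) (q := q) (i := 1) fun k hk =>
        hq.natDegree_le (by omega)
      have h4 : (tailSum G.nodes q 1).coeff (G.nodes - 1) = 0 := by
        rcases Nat.lt_or_ge 1 G.nodes with h5 | h5
        · exact coeff_eq_zero_of_natDegree_lt (by omega)
        · rw [show G.nodes = 1 by omega, tailSum_self, coeff_zero]
      simp only [tailSum_eq_add q (show 0 < G.nodes by omega), coeff_add, coeff_smul, coeff_geom,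
        zero_add, h4, add_zero, if_pos (show G.nodes - 1 < G.nodes by omega)] at h2
      rw [h2]
      have : (G.nodes : ℝ) ≠ 0 := by exact_mod_cast (show G.nodes ≠ 0 by omega)
      simpa using this
    | succ j h1 ih =>
      intro h2 h3
      apply ih (by omega)
      rw [hq.coeff_eq_mul h1 (by omega), h3, mul_zero]
  tailSum_zero := hsum
  dot_eq_zero := hdot

/-- If `p` is orthogonal to the `q k` with `N - d < k < N`, then on polynomials of degree less than
`d` the inner product with `p` is a multiple of evaluation at `1`, as the `q k` span the
polynomials of degree less than `d` that vanish at `1`. -/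
theorem Represents.coeffDot_eq {G : ArcDiagram} {q : ℕ → ℝ[X]} (hq : Represents G q) {p : ℝ[X]}
    {d : ℕ} (hd : d ≤ G.nodes)
    (hp : ∀ k, G.nodes - d < k → k < G.nodes → coeffDot p (q k) = 0) {r : ℝ[X]}
    (hr : r.natDegree < d) : coeffDot p r = r.eval 1 * p.coeff 0 := by
  induction d generalizing r with
  | zero => omega
  | succ d ih =>
    rcases Nat.eq_zero_or_pos d with rfl | hd0
    · rw [eq_C_of_natDegree_eq_zero (show r.natDegree = 0 by omega), C_eq_algebraMap,
        Algebra.algebraMap_eq_smul_one, map_smul, coeffDot_one_right]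
      simp
    · set k := G.nodes - d with hk
      have hne := hq.coeff_ne_zero k (by omega) (by omega)
      have hdeg := hq.natDegree_le k (by omega) (by omega)
      rw [show G.nodes - k = d by omega] at hne hdeg
      set a := r.coeff d / (q k).coeff d with ha
      have hlt : (r - a • q k).natDegree < d := by
        refine Nat.lt_of_le_pred hd0 (natDegree_le_iff_coeff_eq_zero.2 fun m hm => ?_)
        rcases (Nat.le_of_pred_lt hm).eq_or_lt with rfl | hm
        · rw [coeff_sub, coeff_smul, smul_eq_mul, ha, div_mul_cancel₀ _ hne, sub_self]
        · rw [coeff_sub, coeff_smul, coeff_eq_zero_of_natDegree_lt (by omega),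
            coeff_eq_zero_of_natDegree_lt (by omega), smul_zero, sub_zero]
      have h1 := ih (by omega) (fun l hl => hp l (by omega)) hlt
      rwa [map_sub, map_smul, hp k (by omega) (by omega), smul_zero, sub_zero, eval_sub, eval_smul,
        hq.eval_one k (by omega) (by omega), smul_zero, sub_zero] at h1

theorem Represents.coeff_eq {G : ArcDiagram} {q : ℕ → ℝ[X]} (hq : Represents G q) {p : ℝ[X]}
    {d : ℕ} (hd : d ≤ G.nodes)
    (hp : ∀ k, G.nodes - d < k → k < G.nodes → coeffDot p (q k) = 0) {i : ℕ} (hi : i < d) :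
    p.coeff i = p.coeff 0 := by
  have := hq.coeffDot_eq hd hp (r := X ^ i) (by simpa using hi)
  rwa [coeffDot_comm, coeffDot_X_pow_left, eval_pow, eval_X, one_pow, one_mul] at this

/-! ### Gluing families -/

section target

variable (G₁ G₂ : ArcDiagram)

theorem glue_nodes : (G₁.glue G₂).nodes = G₁.nodes + G₂.nodes := rfl

theorem glue_target_of_lt {j : ℕ} (hj : j < G₁.nodes) : (G₁.glue G₂).target j = G₁.target j :=
  if_pos hj

theorem glue_target_self : (G₁.glue G₂).target G₁.nodes = G₁.nodes + G₂.nodes := by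
  simp [ArcDiagram.glue]

theorem glue_target_add {j : ℕ} (h1 : 1 ≤ j) (h2 : j < G₂.nodes) :
    (G₁.glue G₂).target (G₁.nodes + j) = G₁.nodes + G₂.target j := by
  simp only [ArcDiagram.glue]
  rw [if_neg (by omega), if_neg (by omega), if_pos (by omega), Nat.add_sub_cancel_left]

end target

/-- The family of a gluing: the second family, one polynomial for the node that carries the new
arc, and multiples of the first family shifted beyond the degrees of the second. -/
def glueFamily (N₁ N₂ : ℕ) (q₁ q₂ : ℕ → ℝ[X]) (j : ℕ) : ℝ[X] :=
  if j < N₁ then (N₁ / (N₁ + N₂) : ℝ) • (X ^ N₂ * q₁ j)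
  else if j = N₁ then (N₁ / (N₁ + N₂) : ℝ) • (X ^ N₂ - (1 / N₂ : ℝ) • geom N₂)
  else q₂ (j - N₁)

section glueFamily

variable (N₁ N₂ : ℕ) (q₁ q₂ : ℕ → ℝ[X])

theorem glueFamily_of_lt {j : ℕ} (hj : j < N₁) :
    glueFamily N₁ N₂ q₁ q₂ j = (N₁ / (N₁ + N₂) : ℝ) • (X ^ N₂ * q₁ j) := if_pos hj

theorem glueFamily_self :
    glueFamily N₁ N₂ q₁ q₂ N₁ = (N₁ / (N₁ + N₂) : ℝ) • (X ^ N₂ - (1 / N₂ : ℝ) • geom N₂) := by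
  simp [glueFamily]

theorem glueFamily_add {j : ℕ} (hj : 1 ≤ j) : glueFamily N₁ N₂ q₁ q₂ (N₁ + j) = q₂ j := by
  rw [glueFamily, if_neg (by omega), if_neg (by omega), Nat.add_sub_cancel_left]

end glueFamily

theorem tailSum_add (N₁ N₂ : ℕ) (q : ℕ → ℝ[X]) (i : ℕ) :
    tailSum (N₁ + N₂) q (N₁ + i) = tailSum N₂ (fun j => q (N₁ + j)) i := by
  rw [tailSum, tailSum, ← Finset.map_add_left_Ioc, sum_map]
  rfl

theorem tailSum_glueFamily_add (N₁ N₂ : ℕ) (q₁ q₂ : ℕ → ℝ[X]) (i : ℕ) :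
    tailSum (N₁ + N₂) (glueFamily N₁ N₂ q₁ q₂) (N₁ + i) = tailSum N₂ q₂ i := by
  rw [tailSum_add]
  exact tailSum_congr (fun j hj _ => glueFamily_add N₁ N₂ q₁ q₂ hj) i

theorem geom_add (m n : ℕ) : geom (m + n) = geom m + X ^ m * geom n := by
  rw [geom, geom, geom, sum_range_add, mul_sum]
  simp only [pow_add]

theorem tailSum_glueFamily_of_lt {N₁ N₂ : ℕ} (h₂ : 1 ≤ N₂) {q₁ q₂ : ℕ → ℝ[X]}
    (hlast : q₁ N₁ = 1) (hsum : tailSum N₂ q₂ 0 = (1 / N₂ : ℝ) • geom N₂) {i : ℕ} (hi : i < N₁) :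
    tailSum (N₁ + N₂) (glueFamily N₁ N₂ q₁ q₂) i
      = (1 / (N₁ + N₂) : ℝ) • geom N₂ + (N₁ / (N₁ + N₂) : ℝ) • (X ^ N₂ * tailSum N₁ q₁ i) := by
  have hN2 : (N₂ : ℝ) ≠ 0 := by exact_mod_cast (show N₂ ≠ 0 by omega)
  have hN : (N₁ + N₂ : ℝ) ≠ 0 := by positivity
  have h1 : tailSum (N₁ + N₂) (glueFamily N₁ N₂ q₁ q₂) i
      = ∑ k ∈ Ioc i N₁, glueFamily N₁ N₂ q₁ q₂ k + (1 / N₂ : ℝ) • geom N₂ := by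
    rw [← hsum, ← tailSum_glueFamily_add N₁ N₂ q₁ q₂ 0]
    exact (sum_Ioc_consecutive _ hi.le (by omega)).symm
  have h2 : ∑ k ∈ Ioc i N₁, glueFamily N₁ N₂ q₁ q₂ k
      = (N₁ / (N₁ + N₂) : ℝ) • (X ^ N₂ * tailSum N₁ q₁ i)
        - (N₁ / (N₁ + N₂) * (1 / N₂) : ℝ) • geom N₂ := by
    rw [tailSum, ← Ioo_insert_right hi, sum_insert (by simp), sum_insert (by simp), glueFamily_self,
      hlast, sum_congr rfl fun k hk => glueFamily_of_lt N₁ N₂ q₁ q₂ (mem_Ioo.1 hk).2, ← smul_sum,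
      ← mul_sum]
    simp only [mul_add, smul_add, smul_sub, smul_smul, mul_one]
    abel
  rw [h1, h2, sub_add, ← sub_smul, sub_eq_add_neg, ← neg_smul, add_comm]
  congr 2
  field_simp
  ring

theorem tailSum_glueFamily_zero {N₁ N₂ : ℕ} (h₁ : 1 ≤ N₁) (h₂ : 1 ≤ N₂) {q₁ q₂ : ℕ → ℝ[X]}
    (hlast : q₁ N₁ = 1) (hsum₁ : tailSum N₁ q₁ 0 = (1 / N₁ : ℝ) • geom N₁)
    (hsum₂ : tailSum N₂ q₂ 0 = (1 / N₂ : ℝ) • geom N₂) :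
    tailSum (N₁ + N₂) (glueFamily N₁ N₂ q₁ q₂) 0
      = (1 / (N₁ + N₂ : ℕ) : ℝ) • geom (N₁ + N₂) := by
  have hN1 : (N₁ : ℝ) ≠ 0 := by exact_mod_cast (show N₁ ≠ 0 by omega)
  rw [tailSum_glueFamily_of_lt h₂ hlast hsum₂ (by omega), hsum₁, add_comm N₁ N₂, geom_add, smul_add,
    mul_smul_comm, smul_smul]
  push_cast
  congr 2
  · ring
  · field_simp
    ring

theorem natDegree_geom_lt {n : ℕ} (hn : 1 ≤ n) : (geom n).natDegree < n := by
  have : (geom n).natDegree ≤ n - 1 := natDegree_le_iff_coeff_eq_zero.2 fun m hm => by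
    rw [coeff_geom, if_neg (by omega)]
  omega

/-- Within the left part, gluing rescales the inner products. -/
theorem coeffDot_glueFamily_left {N₁ N₂ : ℕ} (h₂ : 1 ≤ N₂) {q₁ q₂ : ℕ → ℝ[X]} (hlast : q₁ N₁ = 1)
    {j k : ℕ} (hjk : j < k) (hk : k ≤ N₁) :
    coeffDot (glueFamily N₁ N₂ q₁ q₂ j) (glueFamily N₁ N₂ q₁ q₂ k)
      = (N₁ / (N₁ + N₂)) ^ 2 * coeffDot (q₁ j) (q₁ k) := by
  rw [glueFamily_of_lt _ _ _ _ (show j < N₁ by omega)]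
  rcases hk.eq_or_lt with rfl | hk
  · simp only [glueFamily_self, hlast, map_smul, LinearMap.smul_apply, map_sub, smul_eq_mul,
      coeffDot_X_pow_mul_left_eq_zero _ (natDegree_geom_lt h₂)]
    rw [← coeffDot_X_pow_mul N₂ (q₁ j) 1, mul_one]
    ring
  · simp only [glueFamily_of_lt _ _ _ _ hk, map_smul, LinearMap.smul_apply, coeffDot_X_pow_mul,
      smul_eq_mul]
    ring

theorem coeffDot_glueFamily_self {N₁ N₂ : ℕ} (q₁ q₂ : ℕ → ℝ[X]) {r : ℝ[X]}
    (hr : r.natDegree < N₂) :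
    coeffDot (glueFamily N₁ N₂ q₁ q₂ N₁) r = -(N₁ / (N₁ + N₂) * (1 / N₂) * r.eval 1) := by
  simp only [glueFamily_self, map_smul, LinearMap.smul_apply, map_sub, LinearMap.sub_apply,
    smul_eq_mul, coeffDot_X_pow_left, coeff_eq_zero_of_natDegree_lt hr]
  rw [coeffDot_comm, coeffDot_geom hr]
  ring

/-- A family with the pattern of a gluing is a glued family. -/
theorem Represents.exists_eq_glueFamily {G₁ G₂ : ArcDiagram} {q : ℕ → ℝ[X]}
    (hq : Represents (G₁.glue G₂) q) :
    ∃ q₁ q₂, Represents G₁ q₁ ∧ Represents G₂ q₂ ∧ ∀ j, 1 ≤ j → j ≤ G₁.nodes + G₂.nodes →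
      q j = glueFamily G₁.nodes G₂.nodes q₁ q₂ j := by
  have h₁ := G₁.nodes_pos
  have h₂ := G₂.nodes_pos
  have hN : (G₁.glue G₂).nodes = G₁.nodes + G₂.nodes := rfl
  set N₁ := G₁.nodes with hN₁
  set N₂ := G₂.nodes with hN₂
  have hN1 : (N₁ : ℝ) ≠ 0 := by exact_mod_cast (show N₁ ≠ 0 by omega)
  have hN2 : (N₂ : ℝ) ≠ 0 := by exact_mod_cast (show N₂ ≠ 0 by omega)
  have hN12 : (N₁ + N₂ : ℝ) ≠ 0 := by positivity
  have htl : ∀ j, j < N₁ → (G₁.glue G₂).target j = G₁.target j := fun j =>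
    glue_target_of_lt G₁ G₂
  have htm : (G₁.glue G₂).target N₁ = N₁ + N₂ := glue_target_self G₁ G₂
  -- nodes of the left part are orthogonal to the inner nodes of the right part
  have horth : ∀ j k, 1 ≤ j → j ≤ N₁ → N₁ + N₂ - N₂ < k → k < N₁ + N₂ →
      coeffDot (q j) (q k) = 0 := by
    intro j k h1 h2 h3 h4
    refine hq.dot_eq_zero j k h1 (by omega) (by omega) ?_
    rcases h2.eq_or_lt with rfl | h2
    · rw [htm]; omega
    · rw [htl j h2]
      have := G₁.target_le j h1 h2
      omega
  -- the tail sum `S_{N₁}` is orthogonal to the inner nodes of the right part, hence a multiple of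
  -- `geom N₂`
  have hS : tailSum (N₁ + N₂) q N₁ = (1 / N₂ : ℝ) • geom N₂ := by
    have hdeg : (tailSum (N₁ + N₂) q N₁).natDegree < N₂ := by
      have := natDegree_tailSum_le (N := N₁ + N₂) (q := q) (i := N₁) fun k hk hk' =>
        hq.natDegree_le k (by omega) hk'
      omega
    have hperp : ∀ k, N₁ + N₂ - N₂ < k → k < N₁ + N₂ →
        coeffDot (tailSum (N₁ + N₂) q N₁) (q k) = 0 := by
      intro k h3 h4
      have h5 : tailSum (N₁ + N₂) q 0
          = ∑ j ∈ Ioc 0 N₁, q j + tailSum (N₁ + N₂) q N₁ :=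
        (sum_Ioc_consecutive _ (by omega) (by omega)).symm
      have h6 : coeffDot (∑ j ∈ Ioc 0 N₁, q j) (q k) = 0 := by
        rw [map_sum, LinearMap.sum_apply]
        refine sum_eq_zero fun j hj => ?_
        rw [mem_Ioc] at hj
        exact horth j k hj.1 hj.2 h3 h4
      have h7 : coeffDot (tailSum (N₁ + N₂) q 0) (q k) = 0 := by
        have := hq.natDegree_le k (by omega) (by omega)
        rw [← hN, hq.tailSum_zero, coeffDot_comm, map_smul, coeffDot_geom (by omega),
          hq.eval_one k (by omega) h4, smul_zero]
      rwa [h5, map_add, LinearMap.add_apply, h6, zero_add] at h7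
    have hc : tailSum (N₁ + N₂) q N₁ = (tailSum (N₁ + N₂) q N₁).coeff 0 • geom N₂ := by
      ext i
      rw [coeff_smul, coeff_geom]
      split_ifs with hi
      · rw [hq.coeff_eq (d := N₂) (by omega) hperp hi, smul_eq_mul, mul_one]
      · rw [coeff_eq_zero_of_natDegree_lt (by omega), smul_zero]
    have he : (tailSum (N₁ + N₂) q N₁).eval 1 = 1 := by
      rw [tailSum, eval_finsetSum, sum_eq_single_of_mem (N₁ + N₂) (by rw [mem_Ioc]; omega)]
      · rw [← hN, hq.last, Polynomial.eval_one]
      · intro k hk hkN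
        rw [mem_Ioc] at hk
        exact hq.eval_one k (by omega) (by omega)
    rw [hc, eval_smul, eval_one_geom, smul_eq_mul] at he
    rw [hc, eq_div_of_mul_eq hN2 he]
  -- the nodes `j < N₁` are orthogonal to the node `N` as well, hence multiples of `X ^ N₂`
  have hdvd : ∀ j, ∃ r, 1 ≤ j → j < N₁ → q j = X ^ N₂ * r := by
    intro j
    by_cases hj : 1 ≤ j ∧ j < N₁
    · have h0 : (q j).coeff 0 = 0 := by
        rw [← coeffDot_one_right, ← hq.last]
        refine hq.dot_eq_zero j _ hj.1 (by omega) le_rfl ?_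
        rw [htl j hj.2]
        have := G₁.target_le j hj.1 hj.2
        omega
      obtain ⟨r, hr⟩ := X_pow_dvd_iff.2 fun d (hd : d < N₂) =>
        (hq.coeff_eq (by omega) (fun k => horth j k hj.1 hj.2.le) hd).trans h0
      exact ⟨r, fun _ _ => hr⟩
    · exact ⟨0, fun h1 h2 => absurd ⟨h1, h2⟩ hj⟩
  choose r hr using hdvd
  let q₁ : ℕ → ℝ[X] := fun j => if j = N₁ then 1 else ((N₁ + N₂) / N₁ : ℝ) • r j
  let q₂ : ℕ → ℝ[X] := fun j => q (N₁ + j)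
  have hq1 : ∀ j, 1 ≤ j → j < N₁ → q j = (N₁ / (N₁ + N₂) : ℝ) • (X ^ N₂ * q₁ j) := by
    intro j h1 h2
    simp only [q₁, if_neg h2.ne, mul_smul_comm, smul_smul]
    rw [div_mul_div_cancel₀ hN12, div_self hN1, one_smul]
    exact hr j h1 h2
  have hlast : q₁ N₁ = 1 := if_pos rfl
  -- `q N₁` is orthogonal to the same nodes, hence `c • geom N₂ + d • X ^ N₂`; the constant
  -- coefficient of `S_0` gives `c`, and the zero at `1` gives `d`
  have hmid : q N₁ = (N₁ / (N₁ + N₂) : ℝ) • (X ^ N₂ - (1 / N₂ : ℝ) • geom N₂) := by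
    have hdeg : (q N₁).natDegree ≤ N₂ := by
      have := hq.natDegree_le N₁ h₁ (by omega)
      omega
    have hc : q N₁ = (q N₁).coeff 0 • geom N₂ + (q N₁).coeff N₂ • X ^ N₂ := by
      ext i
      rw [coeff_add, coeff_smul, coeff_smul, coeff_geom, coeff_X_pow]
      rcases lt_trichotomy i N₂ with hi | rfl | hi
      · rw [if_pos hi, if_neg hi.ne, hq.coeff_eq (by omega) (fun k => horth N₁ k h₁ le_rfl) hi]
        simp
      · simp
      · rw [if_neg (by omega), if_neg (by omega), coeff_eq_zero_of_natDegree_lt (by omega)]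
        simp
    have he := hq.eval_one N₁ h₁ (by omega)
    rw [hc] at he
    simp only [eval_add, eval_smul, eval_one_geom, eval_pow, eval_X, one_pow, smul_eq_mul,
      mul_one] at he
    have h0 : (q N₁).coeff 0 = 1 / (N₁ + N₂) - 1 / N₂ := by
      have h5 := congrArg (fun p => coeff p 0) (sum_Ioc_consecutive q (Nat.zero_le N₁)
        (Nat.le_add_right N₁ N₂))
      have h6 : ∑ j ∈ Ioo 0 N₁, (q j).coeff 0 = 0 := by
        refine sum_eq_zero fun j hj => ?_
        rw [mem_Ioo] at hj
        rw [hr j hj.1 hj.2, coeff_X_pow_mul', if_neg (by omega)]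
      have h7 := hq.tailSum_zero
      rw [hN] at h7
      change coeff (_ + tailSum (N₁ + N₂) q N₁) 0 = coeff (tailSum (N₁ + N₂) q 0) 0 at h5
      rw [hS, h7, ← Ioo_insert_right (by omega), sum_insert (by simp), coeff_add, coeff_add,
        finsetSum_coeff, h6, coeff_smul, coeff_smul, coeff_geom, coeff_geom, if_pos (by omega),
        if_pos (by omega)] at h5
      push_cast at h5
      simp only [smul_eq_mul, mul_one, add_zero] at h5
      linarith
    rw [h0] at hc he
    have h1 : (q N₁).coeff N₂ = N₁ / (N₁ + N₂) := by
      rw [eq_neg_of_add_eq_zero_right he]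
      field_simp
      ring
    have h8 : (1 / (N₁ + N₂) - 1 / N₂ : ℝ) = -(N₁ / (N₁ + N₂) * (1 / N₂)) := by
      field_simp
      ring
    rw [hc, h1, h8, smul_sub, smul_smul, neg_smul]
    abel
  have hglue : ∀ j, 1 ≤ j → j ≤ N₁ + N₂ → q j = glueFamily N₁ N₂ q₁ q₂ j := by
    intro j h1 h2
    rcases lt_trichotomy j N₁ with h3 | rfl | h3
    · rw [hq1 j h1 h3, glueFamily_of_lt _ _ _ _ h3]
    · rw [hmid, glueFamily_self]
    · obtain ⟨l, rfl⟩ := Nat.exists_eq_add_of_lt h3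
      rw [add_assoc, glueFamily_add _ _ _ _ (by omega)]
  have hsum₂ : tailSum N₂ q₂ 0 = (1 / N₂ : ℝ) • geom N₂ := by
    rw [← hS, ← tailSum_add]
    rfl
  have hcoeff : ∀ j, 1 ≤ j → j < N₁ → ∀ m,
      (q j).coeff (m + N₂) = N₁ / (N₁ + N₂) * (q₁ j).coeff m := by
    intro j h1 h2 m
    rw [hq1 j h1 h2, coeff_smul, coeff_X_pow_mul, smul_eq_mul]
  have hne : (N₁ / (N₁ + N₂) : ℝ) ≠ 0 := div_ne_zero hN1 hN12
  refine ⟨q₁, q₂, ⟨hlast, ?_, ?_, ?_, ?_, ?_⟩, ⟨hq.last, ?_, ?_, ?_, hsum₂, ?_⟩, hglue⟩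
  · intro j h1 h2
    have := hq.eval_one j h1 (by omega)
    rw [hq1 j h1 h2, eval_smul, smul_eq_mul] at this
    simpa using (mul_eq_zero.1 this).resolve_left hne
  · intro j h1 h2
    rcases h2.eq_or_lt with rfl | h2
    · rw [hlast]; simp
    · refine natDegree_le_iff_coeff_eq_zero.2 fun m hm => ?_
      have h3 := hcoeff j h1 h2 m
      have h4 := hq.natDegree_le j h1 (by omega)
      rw [coeff_eq_zero_of_natDegree_lt (by omega)] at h3
      exact (mul_eq_zero.1 h3.symm).resolve_left hne
  · intro j h1 h2
    rcases h2.eq_or_lt with rfl | h2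
    · rw [hlast]; simp
    · have h3 := hq.coeff_ne_zero j h1 (by omega)
      rw [hN, show N₁ + N₂ - j = N₁ - j + N₂ by omega, hcoeff j h1 h2] at h3
      exact right_ne_zero_of_mul h3
  · have h3 := hq.tailSum_zero
    rw [hN, tailSum_congr hglue, tailSum_glueFamily_of_lt h₂ hlast hsum₂ h₁] at h3
    ext m
    have h4 := congrArg (fun p => coeff p (m + N₂)) h3
    simp only [coeff_add, coeff_smul, coeff_X_pow_mul, coeff_geom,
      if_neg (show ¬ m + N₂ < N₂ by omega), mul_zero, zero_add, smul_eq_mul,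
      add_lt_add_iff_right] at h4
    rw [coeff_smul, coeff_geom, smul_eq_mul]
    push_cast at h4
    refine mul_left_cancel₀ hne (h4.trans ?_)
    simp only [← hN₁]
    field_simp
  · intro j k h1 h2 h3 h4
    have h5 := hq.dot_eq_zero j k h1 h2 (by omega) (by rwa [htl j (by omega)])
    rw [hglue j h1 (by omega), hglue k (by omega) (by omega),
      coeffDot_glueFamily_left h₂ hlast h2 h3] at h5
    exact (mul_eq_zero.1 h5).resolve_left (pow_ne_zero 2 hne)
  · intro j h1 h2
    exact hq.eval_one _ (by omega) (by omega)
  · intro j h1 h2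
    have := hq.natDegree_le (N₁ + j) (by omega) (by omega)
    rwa [hN, Nat.add_sub_add_left] at this
  · intro j h1 h2
    have := hq.coeff_ne_zero (N₁ + j) (by omega) (by omega)
    rwa [hN, Nat.add_sub_add_left] at this
  · intro j k h1 h2 h3 h4
    refine hq.dot_eq_zero _ _ (by omega) (by omega) (by omega) ?_
    rw [glue_target_add G₁ G₂ h1 (by omega)]
    omega

theorem ArcDiagram.IsBasic.represents_unique {G : ArcDiagram} (hG : G.IsBasic) {q q' : ℕ → ℝ[X]}
    (hq : Represents G q) (hq' : Represents G q') {j : ℕ} (h1 : 1 ≤ j) (h2 : j ≤ G.nodes) :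
    q j = q' j := by
  induction hG generalizing q q' j with
  | single =>
    have : j = 1 := le_antisymm h2 h1
    subst this
    exact hq.last.trans hq'.last.symm
  | @glue G₁ G₂ _ _ ih₁ ih₂ =>
    obtain ⟨q₁, q₂, hq₁, hq₂, h⟩ := hq.exists_eq_glueFamily
    obtain ⟨q₁', q₂', hq₁', hq₂', h'⟩ := hq'.exists_eq_glueFamily
    rw [h j h1 h2, h' j h1 h2]
    rcases lt_trichotomy j G₁.nodes with h3 | rfl | h3
    · rw [glueFamily_of_lt _ _ _ _ h3, glueFamily_of_lt _ _ _ _ h3, ih₁ hq₁ hq₁' h1 h3.le]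
    · rw [glueFamily_self, glueFamily_self]
    · obtain ⟨l, rfl⟩ := Nat.exists_eq_add_of_lt h3
      have h4 : G₁.nodes + (l + 1) ≤ G₁.nodes + G₂.nodes := h2
      rw [add_assoc, glueFamily_add _ _ _ _ (by omega), glueFamily_add _ _ _ _ (by omega),
        ih₂ hq₂ hq₂' (by omega) (by omega)]

/-! ### Gluing and dualizing step sizes -/

/-- The step sizes of a gluing: `h₁` and `h₂` as diagonal blocks, the remaining entries in the row
and in the column `N₁`. -/
def glueStep (N₁ N₂ : ℕ) (h₁ h₂ : ℕ → ℕ → ℝ) (i j : ℕ) : ℝ :=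
  if i < N₁ then h₁ i j
  else if N₁ < j then h₂ (i - N₁) (j - N₁)
  else if i = N₁ then
    if j = N₁ then N₁ * N₂ / (N₁ + N₂) else -(N₂ / (N₁ + N₂)) * ∑ l ∈ Ico j N₁, h₁ l j
  else if j = N₁ then -(N₁ / (N₁ + N₂)) * ∑ l ∈ Icc 1 (i - N₁), h₂ (i - N₁) l
  else 0

/-- The anti-diagonal transpose of step sizes for `N - 1` steps. -/
def dualStep (N : ℕ) (h : ℕ → ℕ → ℝ) (k j : ℕ) : ℝ := h (N - j) (N - k)

/-- The anti-diagonal transpose exchanges the two parts of a gluing. -/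
theorem dualStep_glueStep {N₁ N₂ : ℕ} (h₁ h₂ : ℕ → ℕ → ℝ) {k j : ℕ} (hj : 1 ≤ j) (hjk : j ≤ k)
    (hk : k < N₂ + N₁) :
    dualStep (N₁ + N₂) (glueStep N₁ N₂ h₁ h₂) k j
      = glueStep N₂ N₁ (dualStep N₂ h₂) (dualStep N₁ h₁) k j := by
  rw [dualStep, glueStep, glueStep]
  rcases lt_trichotomy k N₂ with hk2 | rfl | hk2
  · rw [if_neg (by omega), if_pos (by omega), if_pos hk2, dualStep]
    congr 1 <;> omega
  · rcases hjk.eq_or_lt with rfl | hjk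
    · rw [if_neg (by omega), if_neg (by omega), if_pos (by omega), if_pos (by omega),
        if_neg (by omega), if_neg (by omega), if_pos rfl, if_pos rfl]
      ring
    · rw [if_neg (by omega), if_neg (by omega), if_neg (by omega), if_pos (by omega),
        if_neg (by omega), if_neg (by omega), if_pos rfl, if_neg (by omega), add_comm (k : ℝ)]
      congr 1
      refine sum_bij' (fun l _ => k - l) (fun l _ => k - l) ?_ ?_ ?_ ?_ ?_
      all_goals intro l hl; simp only [mem_Icc, mem_Ico] at hl ⊢
      iterate 4 omega
      rw [dualStep]
      congr 1 <;> omega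
  · rcases lt_trichotomy j N₂ with hj2 | rfl | hj2
    · rw [if_neg (by omega), if_neg (by omega), if_neg (by omega), if_neg (by omega),
        if_neg (by omega), if_neg (by omega), if_neg (by omega), if_neg (by omega)]
    · rw [if_neg (by omega), if_neg (by omega), if_pos (by omega), if_neg (by omega),
        if_neg (by omega), if_neg (by omega), if_neg (by omega), if_pos rfl, add_comm (j : ℝ)]
      congr 1
      refine sum_bij' (fun l _ => N₁ - l) (fun l _ => N₁ - l) ?_ ?_ ?_ ?_ ?_
      all_goals intro l hl; simp only [mem_Icc, mem_Ico] at hl ⊢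
      iterate 4 omega
      rw [dualStep]
      congr 1 <;> omega
    · rw [if_pos (by omega), if_neg (by omega), if_pos hj2, dualStep]
      congr 1 <;> omega

theorem columnSum_glue_add {N₁ N₂ : ℕ} (h₁ h₂ : ℕ → ℕ → ℝ) (q₁ q₂ : ℕ → ℝ[X]) {j : ℕ}
    (hj : 1 ≤ j) :
    columnSum (N₁ + N₂) (glueStep N₁ N₂ h₁ h₂) (glueFamily N₁ N₂ q₁ q₂) (N₁ + j)
      = columnSum N₂ h₂ q₂ j := by
  rw [columnSum, columnSum, ← Finset.map_add_left_Ico, sum_map]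
  refine sum_congr rfl fun i hi => ?_
  rw [mem_Ico] at hi
  rw [addLeftEmbedding_apply, tailSum_glueFamily_add, glueStep, if_neg (by omega),
    if_pos (by omega), Nat.add_sub_cancel_left, Nat.add_sub_cancel_left]

theorem columnSum_glue_of_lt {N₁ N₂ : ℕ} (hN₂ : 1 ≤ N₂) (h₁ h₂ : ℕ → ℕ → ℝ) {q₁ q₂ : ℕ → ℝ[X]}
    (hlast : q₁ N₁ = 1) (hsum : tailSum N₂ q₂ 0 = (1 / N₂ : ℝ) • geom N₂) {j : ℕ} (hj : j < N₁) :
    columnSum (N₁ + N₂) (glueStep N₁ N₂ h₁ h₂) (glueFamily N₁ N₂ q₁ q₂) j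
      = (N₁ / (N₁ + N₂) : ℝ) • (X ^ N₂ * columnSum N₁ h₁ q₁ j) := by
  have hN2 : (N₂ : ℝ) ≠ 0 := by exact_mod_cast (show N₂ ≠ 0 by omega)
  have hN : (N₁ + N₂ : ℝ) ≠ 0 := by positivity
  have hleft : ∑ i ∈ Ico j N₁, glueStep N₁ N₂ h₁ h₂ i j • tailSum (N₁ + N₂)
      (glueFamily N₁ N₂ q₁ q₂) i = ((1 / (N₁ + N₂)) * ∑ i ∈ Ico j N₁, h₁ i j : ℝ) • geom N₂
        + (N₁ / (N₁ + N₂) : ℝ) • (X ^ N₂ * columnSum N₁ h₁ q₁ j) := by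
    rw [columnSum, mul_sum, mul_sum, sum_smul, smul_sum, ← sum_add_distrib]
    refine sum_congr rfl fun i hi => ?_
    rw [mem_Ico] at hi
    rw [glueStep, if_pos hi.2, tailSum_glueFamily_of_lt hN₂ hlast hsum hi.2, smul_add, smul_smul,
      mul_smul_comm, smul_comm (h₁ i j), mul_comm (h₁ i j)]
  have hright : ∑ i ∈ Ico (N₁ + 1) (N₁ + N₂), glueStep N₁ N₂ h₁ h₂ i j • tailSum (N₁ + N₂)
      (glueFamily N₁ N₂ q₁ q₂) i = 0 := by
    refine sum_eq_zero fun i hi => ?_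
    rw [mem_Ico] at hi
    rw [glueStep, if_neg (by omega), if_neg (by omega), if_neg (by omega), if_neg (by omega),
      zero_smul]
  have hmid : tailSum (N₁ + N₂) (glueFamily N₁ N₂ q₁ q₂) N₁ = (1 / N₂ : ℝ) • geom N₂ := by
    rw [← hsum, ← tailSum_glueFamily_add N₁ N₂ q₁ q₂ 0, add_zero]
  rw [columnSum, ← sum_Ico_consecutive _ hj.le (Nat.le_add_right N₁ N₂), hleft,
    sum_eq_sum_Ico_succ_bot (show N₁ < N₁ + N₂ by omega), hright, hmid, add_zero, glueStep,
    if_neg (by omega), if_neg (by omega), if_pos rfl, if_neg hj.ne, smul_smul,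
    add_right_comm, ← add_smul]
  rw [show (1 / (N₁ + N₂) * ∑ i ∈ Ico j N₁, h₁ i j
    + -(N₂ / (N₁ + N₂)) * (∑ l ∈ Ico j N₁, h₁ l j) * (1 / N₂) : ℝ) = 0 by field_simp; ring,
    zero_smul, zero_add]

theorem columnSum_glue_self {N₁ N₂ : ℕ} (hN₁ : 1 ≤ N₁) (hN₂ : 1 ≤ N₂) (h₁ h₂ : ℕ → ℕ → ℝ)
    {q₁ q₂ : ℕ → ℝ[X]} (hsum : tailSum N₂ q₂ 0 = (1 / N₂ : ℝ) • geom N₂) :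
    columnSum (N₁ + N₂) (glueStep N₁ N₂ h₁ h₂) (glueFamily N₁ N₂ q₁ q₂) N₁
      = (N₁ / (N₁ + N₂) : ℝ) • (geom N₂ - ∑ l ∈ Ico 1 N₂, columnSum N₂ h₂ q₂ l) := by
  have hN2 : (N₂ : ℝ) ≠ 0 := by exact_mod_cast (show N₂ ≠ 0 by omega)
  have hright : ∑ i ∈ Ico (N₁ + 1) (N₁ + N₂), glueStep N₁ N₂ h₁ h₂ i N₁ • tailSum (N₁ + N₂)
      (glueFamily N₁ N₂ q₁ q₂) i
      = -((N₁ / (N₁ + N₂) : ℝ) • ∑ l ∈ Ico 1 N₂, columnSum N₂ h₂ q₂ l) := by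
    simp only [columnSum]
    rw [sum_comm' (t' := Ico 1 N₂) (s' := fun i => Icc 1 i), ← Finset.map_add_left_Ico, sum_map,
      smul_sum, ← sum_neg_distrib]
    · refine sum_congr rfl fun i hi => ?_
      rw [mem_Ico] at hi
      rw [addLeftEmbedding_apply, tailSum_glueFamily_add, glueStep, if_neg (by omega),
        if_neg (by omega), if_neg (by omega), if_pos rfl, Nat.add_sub_cancel_left, ← sum_smul,
        smul_smul, ← neg_smul, neg_mul]
    · intro l i
      simp only [mem_Ico, mem_Icc]
      omega
  have hmid : tailSum (N₁ + N₂) (glueFamily N₁ N₂ q₁ q₂) N₁ = (1 / N₂ : ℝ) • geom N₂ := by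
    rw [← hsum, ← tailSum_glueFamily_add N₁ N₂ q₁ q₂ 0, add_zero]
  rw [columnSum, sum_eq_sum_Ico_succ_bot (by omega), hright, hmid, glueStep, if_neg (by omega),
    if_neg (by omega), if_pos rfl, if_pos rfl, smul_sub, smul_smul, ← sub_eq_add_neg]
  congr 2
  field_simp

theorem isGenerated_glue {N₁ N₂ : ℕ} (hN₁ : 1 ≤ N₁) (hN₂ : 1 ≤ N₂) {h₁ h₂ : ℕ → ℕ → ℝ}
    {q₁ q₂ : ℕ → ℝ[X]} (hq₁ : IsGenerated N₁ h₁ q₁) (hq₂ : IsGenerated N₂ h₂ q₂)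
    (hsum : tailSum N₂ q₂ 0 = (1 / N₂ : ℝ) • geom N₂) :
    IsGenerated (N₁ + N₂) (glueStep N₁ N₂ h₁ h₂) (glueFamily N₁ N₂ q₁ q₂) where
  last := by rw [glueFamily_add _ _ _ _ hN₂, hq₂.last]
  eq_mul := by
    intro j h1 h2
    rcases lt_trichotomy j N₁ with h3 | rfl | h3
    · rw [columnSum_glue_of_lt hN₂ h₁ h₂ hq₁.last hsum h3, glueFamily_of_lt _ _ _ _ h3,
        hq₁.eq_mul j h1 h3, mul_smul_comm, mul_left_comm]
    · rw [columnSum_glue_self hN₁ hN₂ h₁ h₂ hsum, glueFamily_self, mul_smul_comm, mul_sub,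
        X_sub_one_mul_geom, mul_sum, ← sum_congr rfl fun l hl => hq₂.eq_mul l (mem_Ico.1 hl).1
          (mem_Ico.1 hl).2, ← hsum]
      have : tailSum N₂ q₂ 0 = 1 + ∑ l ∈ Ico 1 N₂, q₂ l := by
        rw [← hq₂.last, ← sum_insert (by simp), Ico_insert_right hN₂]
        rfl
      rw [this]
      congr 1
      abel
    · obtain ⟨l, rfl⟩ := Nat.exists_eq_add_of_lt h3
      rw [add_assoc, columnSum_glue_add _ _ _ _ (by omega), glueFamily_add _ _ _ _ (by omega),
        hq₂.eq_mul (l + 1) (by omega) (by omega)]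

/-- The step sizes `h` are optimal, with certificates supported exactly on the arcs of `G`. -/
def Realizes (G : ArcDiagram) (h : ℕ → ℕ → ℝ) : Prop :=
  ∃ q, IsGenerated G.nodes h q ∧ Represents G q ∧
    ∀ j, 1 ≤ j → j < G.nodes → coeffDot (q j) (q (G.target j)) < 0

theorem Realizes.congr {G : ArcDiagram} {h h' : ℕ → ℕ → ℝ} (hG : Realizes G h)
    (hh : ∀ i j, 1 ≤ j → j ≤ i → i < G.nodes → h i j = h' i j) : Realizes G h' := by
  obtain ⟨q, hq, hr⟩ := hG
  exact ⟨q, hq.congr G.nodes_pos hh fun _ _ _ => rfl, hr⟩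

theorem realizes_single (h : ℕ → ℕ → ℝ) : Realizes .single h := by
  have hn : ArcDiagram.single.nodes = 1 := rfl
  have hq : IsGenerated ArcDiagram.single.nodes h fun _ => 1 := ⟨rfl, fun j h1 h2 => by omega⟩
  refine ⟨_, hq, hq.represents ?_ fun j k h1 h2 h3 => by omega, fun j h1 h2 => by omega⟩
  simp [hn, tailSum, geom]

theorem Realizes.glue {G₁ G₂ : ArcDiagram} {h₁ h₂ : ℕ → ℕ → ℝ} (hr₁ : Realizes G₁ h₁)
    (hr₂ : Realizes G₂ h₂) :
    Realizes (G₁.glue G₂) (glueStep G₁.nodes G₂.nodes h₁ h₂) := by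
  obtain ⟨q₁, hg₁, hq₁, hp₁⟩ := hr₁
  obtain ⟨q₂, hg₂, hq₂, hp₂⟩ := hr₂
  have hN₁ := G₁.nodes_pos
  have hN₂ := G₂.nodes_pos
  have hN1 : (0 : ℝ) < G₁.nodes := by exact_mod_cast hN₁
  have hN2 : (0 : ℝ) < G₂.nodes := by exact_mod_cast hN₂
  have hg := isGenerated_glue hN₁ hN₂ hg₁ hg₂ hq₂.tailSum_zero
  have hleft : ∀ j k, j < k → k ≤ G₁.nodes →
      coeffDot (glueFamily G₁.nodes G₂.nodes q₁ q₂ j) (glueFamily G₁.nodes G₂.nodes q₁ q₂ k)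
        = (G₁.nodes / (G₁.nodes + G₂.nodes)) ^ 2 * coeffDot (q₁ j) (q₁ k) := fun j k =>
    coeffDot_glueFamily_left hN₂ hg₁.last
  have hright : ∀ l, 1 ≤ l → glueFamily G₁.nodes G₂.nodes q₁ q₂ (G₁.nodes + l) = q₂ l := fun l =>
    glueFamily_add _ _ _ _
  have hdeg : ∀ l, 1 ≤ l → l ≤ G₂.nodes → (q₂ l).natDegree < G₂.nodes := fun l h1 h2 => by
    have := hg₂.natDegree_le h1 h2
    omega
  refine ⟨_, hg, hg.represents ?_ ?_, ?_⟩
  · exact tailSum_glueFamily_zero hN₁ hN₂ hg₁.last hq₁.tailSum_zero hq₂.tailSum_zero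
  · intro j k h1 h2 h3 h4
    rw [glue_nodes] at h3
    rcases le_or_gt k G₁.nodes with h5 | h5
    · rw [glue_target_of_lt _ _ (by omega)] at h4
      rw [hleft j k h2 h5, hq₁.dot_eq_zero j k h1 h2 h5 h4, mul_zero]
    · obtain ⟨l, hl, rfl⟩ : ∃ l, 1 ≤ l ∧ k = G₁.nodes + l := ⟨k - G₁.nodes, by omega, by omega⟩
      rw [hright l hl]
      rcases lt_trichotomy j G₁.nodes with h6 | rfl | h6
      · rw [glueFamily_of_lt _ _ _ _ h6, map_smul, LinearMap.smul_apply,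
          coeffDot_X_pow_mul_left_eq_zero _ (hdeg l hl (by omega)), smul_zero]
      · rw [glue_target_self] at h4
        rw [coeffDot_glueFamily_self _ _ (hdeg l hl (by omega)), hg₂.eval_one hl (by omega),
          mul_zero, neg_zero]
      · obtain ⟨i, hi, rfl⟩ : ∃ i, 1 ≤ i ∧ j = G₁.nodes + i := ⟨j - G₁.nodes, by omega, by omega⟩
        rw [glue_target_add _ _ hi (by omega)] at h4
        rw [hright i hi]
        exact hq₂.dot_eq_zero i l hi (by omega) (by omega) (by omega)
  · intro j h1 h2
    rw [glue_nodes] at h2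
    rcases lt_trichotomy j G₁.nodes with h6 | rfl | h6
    · rw [glue_target_of_lt _ _ h6, hleft j _ (G₁.lt_target j h1 h6) (G₁.target_le j h1 h6)]
      exact mul_neg_of_pos_of_neg (by positivity) (hp₁ j h1 h6)
    · rw [glue_target_self, hright _ hN₂, coeffDot_glueFamily_self _ _ (hdeg _ hN₂ le_rfl),
        hg₂.last, Polynomial.eval_one, mul_one, neg_lt_zero]
      positivity
    · obtain ⟨i, hi, rfl⟩ : ∃ i, 1 ≤ i ∧ j = G₁.nodes + i := ⟨j - G₁.nodes, by omega, by omega⟩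
      have := G₂.lt_target i hi (by omega)
      rw [glue_target_add _ _ hi (by omega), hright i hi, hright _ (by omega)]
      exact hp₂ i hi (by omega)

/-! ### Vertex algorithms -/

theorem entry_eq {N : ℕ} (H : HMatrix N) (i j : Fin (N - 1)) : entry H (i + 1) (j + 1) = H i j := by
  rw [entry, dif_pos (by omega)]
  rfl

theorem entry_hDual {N : ℕ} (H : HMatrix N) {k j : ℕ} (hj : 1 ≤ j) (hjk : j ≤ k) (hk : k < N) :
    entry (hDual H) k j = dualStep N (entry H) k j := by
  rw [dualStep, entry, entry, dif_pos (by omega), dif_pos (by omega), hDual, Matrix.of_apply]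
  congr 1 <;> ext <;> simp <;> omega

theorem IsIterates.eq_sub {N : ℕ} {H : HMatrix N} {E : Type} [NormedAddCommGroup E]
    [InnerProductSpace ℝ E] {T : E → E} {y : ℕ → E} (hy : IsIterates H T y) {k : ℕ} (h1 : 1 ≤ k)
    (h2 : k < N) :
    y k = y (k - 1) - ∑ j ∈ Icc 1 k, entry H k j • (y (j - 1) - T (y (j - 1))) := by
  have := hy (k - 1) (by omega)
  rw [Nat.sub_add_cancel h1] at this
  rw [sum_Icc_one_eq_sum_range]
  exact this

/-- Vertex algorithms are described by their generated families: the optimal rate amounts to the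
value of `q 1 + ⋯ + q N` once the inner products `⟨q j, q k⟩ = -λ_{k,j} / N` are nonpositive. -/
theorem isVertexWithDiagram_iff {N : ℕ} {H : HMatrix N} {G : ArcDiagram} :
    IsVertexWithDiagram H G ↔ G.nodes = N ∧ IsLowerTriangular H ∧ Realizes G (entry H) := by
  have hgen := isGenerated_qPoly H
  constructor
  · rintro ⟨⟨⟨hlow, hopt⟩, hpos⟩, rfl, hcert⟩
    have hN := G.nodes_pos
    have hN0 : (0 : ℝ) < G.nodes := by exact_mod_cast hN
    have hsum := hgen.tailSum_eq_geom hN fun T hT hT0 y hy => by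
      have := hopt _ T hT 0 hT0 y fun k hk => by
        rw [hy (k + 1) (by omega) (by omega), sum_Icc_one_eq_sum_range]
        rfl
      rwa [sub_zero] at this
    refine ⟨rfl, hlow, qPoly H, hgen, hgen.represents hsum fun j k h1 h2 h3 h4 => ?_,
      fun j h1 h2 => ?_⟩
    · have h5 : certificate H k j = 0 := by
        by_contra h
        exact h4 ((hcert j k h1 h2 h3).1 h)
      rw [certificate_eq H h2 h3, neg_eq_zero] at h5
      exact (mul_eq_zero.1 h5).resolve_left hN0.ne'
    · obtain ⟨k, h3, h4, h5, -⟩ := hpos j h1 h2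
      rw [(hcert j k h1 h3 h4).1 h5.ne']
      rw [certificate_eq H h3 h4, neg_pos] at h5
      exact neg_of_mul_neg_right h5 hN0.le
  · rintro ⟨rfl, hlow, q, hq, hrep, hneg⟩
    have hN := G.nodes_pos
    have hN0 : (0 : ℝ) < G.nodes := by exact_mod_cast hN
    have hcert : ∀ j k, 1 ≤ j → j < k → k ≤ G.nodes →
        certificate H k j = -(G.nodes * coeffDot (q j) (q k)) := fun j k h1 h2 h3 => by
      rw [certificate_eq H h2 h3, hgen.unique hq h1 (by omega), hgen.unique hq (by omega) h3]
    have hzero : ∀ j k, 1 ≤ j → j < k → k ≤ G.nodes → G.target j ≠ k → certificate H k j = 0 :=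
      fun j k h1 h2 h3 h4 => by
        rw [hcert j k h1 h2 h3, hrep.dot_eq_zero j k h1 h2 h3 h4, mul_zero, neg_zero]
    have hpos : ∀ j, 1 ≤ j → j < G.nodes → 0 < certificate H (G.target j) j := fun j h1 h2 => by
      rw [hcert j _ h1 (G.lt_target j h1 h2) (G.target_le j h1 h2), neg_pos]
      exact mul_neg_of_pos_of_neg hN0 (hneg j h1 h2)
    refine ⟨⟨⟨hlow, ?_⟩, fun j h1 h2 => ⟨G.target j, G.lt_target j h1 h2, G.target_le j h1 h2,
      hpos j h1 h2, fun l h3 h4 h5 => hzero j l h1 h3 h4 (Ne.symm h5)⟩⟩, rfl, ?_⟩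
    · intro E _ _ _ T hT p hp y hy
      refine hq.norm_residual_le hN hrep.tailSum_zero (fun j k h1 h2 h3 => ?_) hT hp
        fun k h1 h2 => hy.eq_sub h1 h2
      by_cases h4 : G.target j = k
      · rw [← h4]
        exact (hneg j h1 (by omega)).le
      · exact (hrep.dot_eq_zero j k h1 h2 h3 h4).le
    · intro j k h1 h2 h3
      refine ⟨fun h => by_contra fun h4 => h (hzero j k h1 h2 h3 h4), ?_⟩
      rintro rfl
      exact (hpos j h1 (by omega)).ne'

/-- The step sizes realizing a basic diagram are unique in the lower triangular range. -/
theorem ArcDiagram.IsBasic.step_unique {G : ArcDiagram} (hG : G.IsBasic) {h h' : ℕ → ℕ → ℝ}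
    (hh : Realizes G h) (hh' : Realizes G h') {i j : ℕ} (h1 : 1 ≤ j) (h2 : j ≤ i)
    (h3 : i < G.nodes) : h i j = h' i j := by
  obtain ⟨q, hq, hr, -⟩ := hh
  obtain ⟨q', hq', hr', -⟩ := hh'
  exact hq.step_unique (hq'.congr G.nodes_pos (fun _ _ _ _ _ => rfl)
    fun j h1 h2 => hG.represents_unique hr' hr h1 h2) hr.coeff_ne_zero h1 h2 h3

/-- The lower triangular matrix with entries `h_{i,j}`. -/
def stepMatrix (N : ℕ) (h : ℕ → ℕ → ℝ) : HMatrix N :=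
  Matrix.of fun i j => if j ≤ i then h (i + 1) (j + 1) else 0

theorem entry_stepMatrix {N : ℕ} (h : ℕ → ℕ → ℝ) {i j : ℕ} (h1 : 1 ≤ j) (h2 : j ≤ i) (h3 : i < N) :
    entry (stepMatrix N h) i j = h i j := by
  rw [entry, dif_pos (by omega), stepMatrix, Matrix.of_apply, if_pos (by simp; omega)]
  congr 1 <;> simp <;> omega

theorem isLowerTriangular_stepMatrix (N : ℕ) (h : ℕ → ℕ → ℝ) :
    IsLowerTriangular (stepMatrix N h) := fun _ _ hij => if_neg hij.not_ge

theorem IsLowerTriangular.hDual {N : ℕ} {H : HMatrix N} (hH : IsLowerTriangular H) :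
    IsLowerTriangular (hDual H) := fun _ _ hij => hH _ _ (Fin.rev_lt_rev.2 hij)

/-- Step sizes realizing `G` whose anti-diagonal transpose realizes `D` exist. -/
def DuallyRealized (G D : ArcDiagram) : Prop :=
  D.nodes = G.nodes ∧ ∃ h, Realizes G h ∧ Realizes D (dualStep G.nodes h)

theorem DuallyRealized.glue {G₁ G₂ D₁ D₂ : ArcDiagram} (h₁ : DuallyRealized G₁ D₁)
    (h₂ : DuallyRealized G₂ D₂) : DuallyRealized (G₁.glue G₂) (D₂.glue D₁) := by
  obtain ⟨hn₁, s₁, hG₁, hD₁⟩ := h₁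
  obtain ⟨hn₂, s₂, hG₂, hD₂⟩ := h₂
  refine ⟨by rw [glue_nodes, glue_nodes, hn₁, hn₂, add_comm], _, hG₁.glue hG₂,
    (hD₂.glue hD₁).congr fun i j h1 h2 h3 => ?_⟩
  rw [glue_nodes, hn₁, hn₂] at h3
  rw [glue_nodes, dualStep_glueStep _ _ h1 h2 h3, hn₁, hn₂]

theorem ArcDiagram.IsBasic.exists_duallyRealized {G : ArcDiagram} (hG : G.IsBasic) :
    ∃ D, DuallyRealized G D := by
  induction hG with
  | single => exact ⟨.single, rfl, fun _ _ => 0, realizes_single _, realizes_single _⟩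
  | glue _ _ ih₁ ih₂ =>
    obtain ⟨D₁, h₁⟩ := ih₁
    obtain ⟨D₂, h₂⟩ := ih₂
    exact ⟨_, h₁.glue h₂⟩

theorem DuallyRealized.isHDual {G D : ArcDiagram} (hGD : DuallyRealized G D) (hG : G.IsBasic) :
    G.IsHDual D := by
  obtain ⟨hn, h, hr, hd⟩ := hGD
  have hex : IsVertexWithDiagram (stepMatrix G.nodes h) G := isVertexWithDiagram_iff.2
    ⟨rfl, isLowerTriangular_stepMatrix _ _, hr.congr fun i j h1 h2 h3 =>
      (entry_stepMatrix h h1 h2 h3).symm⟩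
  refine ⟨⟨_, hex, fun H hH => ?_⟩, fun H hH => ?_⟩
  · obtain ⟨-, hlow, hr'⟩ := isVertexWithDiagram_iff.1 hH
    refine Matrix.ext fun i j => ?_
    rcases le_or_gt j i with hji | hij
    · rw [← entry_eq H i j, ← entry_eq (stepMatrix G.nodes h) i j,
        hG.step_unique hr' hr (by omega) (by simpa using hji) (by omega),
        entry_stepMatrix h (by omega) (by simpa using hji) (by omega)]
    · rw [hlow i j hij, isLowerTriangular_stepMatrix _ _ i j hij]
  · obtain ⟨-, hlow, hr'⟩ := isVertexWithDiagram_iff.1 hH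
    refine isVertexWithDiagram_iff.2 ⟨hn, hlow.hDual, hd.congr fun i j h1 h2 h3 => ?_⟩
    rw [hn] at h3
    rw [entry_hDual H h1 h2 h3, dualStep, dualStep]
    exact hG.step_unique hr hr' (by omega) (by omega) (by omega)

/-! ### Decompositions of a gluing -/

/-- A gluing is decomposable at its joint only. -/
theorem eq_nodes_of_decomposableAt_glue {G₁ G₂ : ArcDiagram} {n : ℕ}
    (h : (G₁.glue G₂).DecomposableAt n) : n = G₁.nodes := by
  obtain ⟨h1, h2, h3, h4⟩ := h
  have hN₁ := G₁.nodes_pos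
  have hN₂ := G₂.nodes_pos
  rw [glue_nodes] at h2 h3
  rcases lt_trichotomy n G₁.nodes with h5 | h5 | h5
  · have := G₁.target_le n h1 h5
    rw [glue_target_of_lt _ _ h5] at h3
    omega
  · exact h5
  · have := h4 _ hN₁ h5
    rw [glue_target_self] at this
    omega

theorem left_glue {G₁ G₂ : ArcDiagram} (h : (G₁.glue G₂).DecomposableAt G₁.nodes) :
    (G₁.glue G₂).left G₁.nodes h = G₁ := by
  refine ArcDiagram.ext rfl (funext fun j => ?_)
  change (if j < G₁.nodes then (G₁.glue G₂).target j else 0) = _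
  split_ifs with hj
  · exact glue_target_of_lt _ _ hj
  · rw [G₁.target_eq_zero j (by omega)]

theorem right_glue {G₁ G₂ : ArcDiagram} (h : (G₁.glue G₂).DecomposableAt G₁.nodes) :
    (G₁.glue G₂).right G₁.nodes h = G₂ := by
  have hn : (G₁.glue G₂).nodes - G₁.nodes = G₂.nodes := by rw [glue_nodes]; omega
  refine ArcDiagram.ext hn (funext fun j => ?_)
  change (if 1 ≤ j ∧ j < (G₁.glue G₂).nodes - G₁.nodes then
    (G₁.glue G₂).target (G₁.nodes + j) - G₁.nodes else 0) = _
  rw [hn]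
  split_ifs with hj
  · rw [glue_target_add _ _ hj.1 hj.2, Nat.add_sub_cancel_left]
  · rw [G₂.target_eq_zero j hj]

end ArcDuality

end

theorem mainTheorem4 (G : ArcDuality.ArcDiagram) (hG : G.IsBasic)
    (N' : ℕ) (hN' : G.DecomposableAt N') :
    ∃ L R : ArcDuality.ArcDiagram,
      (G.left N' hN').IsHDual L ∧ (G.right N' hN').IsHDual R ∧ G.IsHDual (R.glue L) := by
  cases hG with
  | single => exact absurd hN'.2.1 (by have := hN'.1; change ¬ N' < 1; omega)
  | @glue G₁ G₂ h₁ h₂ =>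
    obtain rfl := ArcDuality.eq_nodes_of_decomposableAt_glue hN'
    obtain ⟨L, hL⟩ := h₁.exists_duallyRealized
    obtain ⟨R, hR⟩ := h₂.exists_duallyRealized
    rw [ArcDuality.left_glue, ArcDuality.right_glue]
    exact ⟨L, R, hL.isHDual h₁, hR.isHDual h₂, (hL.glue hR).isHDual (h₁.glue h₂)⟩
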